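/- A \emph{linear space} is a set $A$ with a ternary relation $R$ that holds only of triples of distinct points, is invariant under permutations, and is such that any two distinct points lie in a unique maximal $R$-clique (\emph{line}); a line is non-trivial if it has at least $3$ points. For a finite linear space $A$ put $$\delta(A)=|A|-\sum_{\ell}(|\ell|-2),$$ the sum being over the non-trivial lines $\ell$ of $A$; subsets carry the induced structure. Write $\delta(C/B)=\delta(B\cup C)-\delta(B)$, and $A\le B$ if $A\subseteq B$ and $\delta(A)\le\delta(X)$ whenever $A\subseteq X\subseteq B$. A \emph{strong embedding} $A\to B$ is an isomorphism of $A$ onto some induced substructure $A'\le B$. Let $K^{sp}_0$ be the class of finite linear spaces $A$ such that every $B\subseteq A$ satisfies $$(\#)\qquad |B|>1\Rightarrow\delta(B)>1\quad\text{and}\quad |B|>3\Rightarrow\delta(B)>2 .$$ A class $K$ of finite linear spaces has \emph{$\le$-amalgamation} if for all $A,B,C\in K$ and strong embeddings $i:C\to A$, $j:C\to B$ there are $D\in K$ and strong embeddings $f:A\to D$, $g:B\to D$ with $f\circ i=g\circ j$. For disjoint subsets $B,C$ of a structure, with $C\ne\emptyset$, $C$ is \emph{$0$-primitive} over $B$ if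 $B\le B\cup C$, $\delta(C/B)=0$, and there is no $X$ with $B\subsetneq X\subsetneq B\cup C$ and $B\le X\le B\cup C$. The pair $(B,C)$ is \emph{good} if $C$ is $0$-primitive over $B$ and over no proper subset of $B$. Let $\boldsymbol\alpha$ be the isomorphism type of the good pair $(\{b_1,b_2\},\{a\})$ with $R(b_1,b_2,a)$. Let $\mathcal U$ be the set of functions $\mu$ assigning a natural number to each isomorphism type of good pairs $(B,C)$ with $B\cup C\in K^{sp}_0$ such that $\mu(B,C)\ge\delta(B)$ if $|C|\ge 2$, and $\mu(\boldsymbol\alpha)\ge 1$. For $\mu\in\mathcal U$ let $K^{sp}_\mu$ be the class of all $M\in K^{sp}_0$ such that, for every good pair $(B,C)$ with $B\cup C\in K^{sp}_0$ and every embedding of $B$ into $M$, there are at most $\mu(B,C)$ pairwise disjoint copies of $C$ over $B$ in $M$. \textbf{Theorem.} (1) $(K^{sp}_0,\le)$ has $\le$-amalgamation. (2) In (1), $D$, $f$ and $g$ can be chosen so that $D$ is the free linear-space amalgam of $f(A)$ and $g(B)$ over $f(A)\cap g(B)$; that is, $D=f(A)\cup g(B)$, and points $a\in f(A)\setminus g(B)$,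 $b\in g(B)\setminus f(A)$ lie on a common non-trivial line of $D$ if and only if there are distinct $c_1,c_2\in f(A)\cap g(B)$ with $R(c_1,c_2,a)$ and $R(c_1,c_2,b)$. Moreover they can be chosen so that, in addition, $f(A)\cap g(B)=f(i(C))$, unless there are distinct $c_1,c_2\in C$ and points $a\in A\setminus i(C)$, $b\in B\setminus j(C)$ with $R(i(c_1),i(c_2),a)$ and $R(j(c_1),j(c_2),b)$. (3) For every $\mu\in\mathcal U$, the class $K^{sp}_\mu$ has $\le$-amalgamation. This includes in particular every $\mu\in\mathcal U^{sp}$, the set of those $\mu\in\mathcal U$ whose values can be achieved in $K^{sp}_0$ (so that $\mu(\boldsymbol\alpha)=1$). -/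

import Mathlib

universe u

/-- A structure for the vocabulary with a single ternary relation symbol. -/
structure TernStr : Type (u + 1) where
  carrier : Type u
  rel : carrier → carrier → carrier → Prop

namespace TernStr

/-- `R` holds only of triples of distinct elements, and in any order. -/
def IsThreeHypergraph (M : TernStr.{u}) : Prop :=
  (∀ x y z, M.rel x y z → x ≠ y ∧ x ≠ z ∧ y ≠ z) ∧
  (∀ x y z, M.rel x y z → M.rel y x z) ∧
  (∀ x y z, M.rel x y z → M.rel x z y)

/-- All triples of distinct elements of `S` satisfy `R`. -/
def IsClique (M : TernStr.{u}) (S : Set M.carrier) : Prop :=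
  ∀ x ∈ S, ∀ y ∈ S, ∀ z ∈ S, x ≠ y → x ≠ z → y ≠ z → M.rel x y z

/-- `ℓ` is a line (a maximal clique) of the substructure of `M` with universe `S`. -/
def IsLineOf (M : TernStr.{u}) (S ℓ : Set M.carrier) : Prop :=
  Maximal (fun X => X ⊆ S ∧ M.IsClique X) ℓ

/-- Linear spaces: any two distinct points lie on a unique line. -/
def IsLinearSpace (M : TernStr.{u}) : Prop :=
  M.IsThreeHypergraph ∧
  ∀ a b : M.carrier, a ≠ b → ∃! ℓ : Set M.carrier, M.IsLineOf Set.univ ℓ ∧ a ∈ ℓ ∧ b ∈ ℓ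

/-- The non-trivial lines (those with at least three points) of the substructure on `S`. -/
def nontrivialLines (M : TernStr.{u}) (S : Set M.carrier) : Set (Set M.carrier) :=
  {ℓ | M.IsLineOf S ℓ ∧ 3 ≤ ℓ.ncard}

/-- The predimension of the (finite) substructure of `M` with universe `S`:
the number of points minus the sum of the nullities `|ℓ| - 2` of its non-trivial lines. -/
noncomputable def delta (M : TernStr.{u}) (S : Set M.carrier) : ℤ :=
  (S.ncard : ℤ) - ∑ᶠ ℓ ∈ M.nontrivialLines S, ((ℓ.ncard : ℤ) - 2)

/-- `X ≤ Y` for substructures `X`, `Y` of the finite structure `M`. -/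
def Strong (M : TernStr.{u}) (X Y : Set M.carrier) : Prop :=
  X ⊆ Y ∧ ∀ Z, X ⊆ Z → Z ⊆ Y → M.delta X ≤ M.delta Z

/-- The class of finite linear spaces all of whose substructures satisfy the sparseness
condition. -/
def KSp (M : TernStr.{u}) : Prop :=
  Finite M.carrier ∧ M.IsLinearSpace ∧
  ∀ B : Set M.carrier,
    (1 < B.ncard → 1 < M.delta B) ∧ (3 < B.ncard → 2 < M.delta B)

/-- Embeddings (isomorphisms onto an induced substructure). -/
structure Emb (M N : TernStr.{u}) where
  toFun : M.carrier → N.carrier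
  injective : Function.Injective toFun
  rel_iff : ∀ x y z, N.rel (toFun x) (toFun y) (toFun z) ↔ M.rel x y z

/-- The image of the embedding, as a substructure of the target. -/
def Emb.image {M N : TernStr.{u}} (f : Emb M N) : Set N.carrier := Set.range f.toFun

/-- The image of the embedding is strong in the target. -/
def Emb.IsStrong {M N : TernStr.{u}} (f : Emb M N) : Prop := N.Strong f.image Set.univ

/-- `≤`-amalgamation of a class `K` of finite structures. -/
def HasStrongAmalgamation (K : TernStr.{u} → Prop) : Prop :=
  ∀ (A B C : TernStr.{u}), K A → K B → K C →
    ∀ (i : Emb C A) (j : Emb C B), i.IsStrong → j.IsStrong →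
      ∃ (D : TernStr.{u}) (f : Emb A D) (g : Emb B D),
        K D ∧ f.IsStrong ∧ g.IsStrong ∧ ∀ c, f.toFun (i.toFun c) = g.toFun (j.toFun c)

/-- The linear space `D` is the free amalgam of its substructures `X` and `Y` over `X ∩ Y`:
it has no further points, and points `a ∈ X \ Y`, `b ∈ Y \ X` lie on a common non-trivial line
exactly if they both lie on one line based in (having two points in) `X ∩ Y`. -/
def IsFreeAmalgam (D : TernStr.{u}) (X Y : Set D.carrier) : Prop :=
  X ∪ Y = Set.univ ∧
  ∀ a ∈ X \ Y, ∀ b ∈ Y \ X,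
    ((∃ d, D.rel a b d) ↔
      ∃ c₁ ∈ X ∩ Y, ∃ c₂ ∈ X ∩ Y, c₁ ≠ c₂ ∧ D.rel c₁ c₂ a ∧ D.rel c₁ c₂ b)

/-- Some line based in `C` acquires a point outside `C` in `A` and a point outside `C` in `B`. -/
def SharesExtendedLine {A B C : TernStr.{u}} (i : Emb C A) (j : Emb C B) : Prop :=
  ∃ c₁ c₂ : C.carrier, c₁ ≠ c₂ ∧
    (∃ a, a ∉ i.image ∧ A.rel (i.toFun c₁) (i.toFun c₂) a) ∧
    (∃ b, b ∉ j.image ∧ B.rel (j.toFun c₁) (j.toFun c₂) b)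

/-- `C` (non-empty, disjoint from `B`) is `0`-primitive over `B`. -/
def IsZeroPrimitive (M : TernStr.{u}) (C B : Set M.carrier) : Prop :=
  C.Nonempty ∧ Disjoint C B ∧ M.Strong B (B ∪ C) ∧
  (¬ ∃ X, B ⊂ X ∧ X ⊂ B ∪ C ∧ M.Strong B X ∧ M.Strong X (B ∪ C)) ∧
  M.delta (B ∪ C) - M.delta B = 0

/-- `C / B` is good: `0`-primitive, and not `0`-primitive over a proper subset of `B`. -/
def IsGood (M : TernStr.{u}) (C B : Set M.carrier) : Prop :=
  M.IsZeroPrimitive C B ∧ ∀ B', B' ⊂ B → ¬ M.IsZeroPrimitive C B'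

/-- Good pairs `(B, C)` in the class `KSp`: a structure in the class with universe `B ∪ C`,
given by its base `B`; then `C` is the complement of `B`. -/
structure GoodPair : Type (u + 1) where
  str : TernStr.{u}
  base : Set str.carrier
  mem : str.KSp
  good : str.IsGood baseᶜ base

/-- Isomorphism of good pairs. -/
def GoodPair.Iso (P Q : GoodPair.{u}) : Prop :=
  ∃ e : P.str.carrier ≃ Q.str.carrier,
    (∀ x y z, Q.str.rel (e x) (e y) (e z) ↔ P.str.rel x y z) ∧
    ∀ x, e x ∈ Q.base ↔ x ∈ P.base

instance GoodPair.isoSetoid : Setoid GoodPair.{u} where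
  r := GoodPair.Iso
  iseqv :=
    { refl := fun P => ⟨Equiv.refl _, fun _ _ _ => Iff.rfl, fun _ => Iff.rfl⟩
      symm := by
        rintro P Q ⟨e, h₁, h₂⟩
        refine ⟨e.symm, fun x y z => ?_, fun x => ?_⟩
        · simpa using (h₁ (e.symm x) (e.symm y) (e.symm z)).symm
        · simpa using (h₂ (e.symm x)).symm
      trans := by
        rintro P Q S ⟨e, h₁, h₂⟩ ⟨e', h₁', h₂'⟩
        exact ⟨e.trans e', fun x y z => (h₁' _ _ _).trans (h₁ x y z),
          fun x => (h₂' _).trans (h₂ x)⟩ }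

/-- Isomorphism types of good pairs in the class `KSp`. -/
def GoodPairType : Type (u + 1) := Quotient GoodPair.isoSetoid.{u}

/-- The isomorphism type of a good pair. -/
def GoodPair.type (P : GoodPair.{u}) : GoodPairType.{u} := Quotient.mk GoodPair.isoSetoid P

/-- The good pair `({b₁, b₂}, a)` with `R(b₁, b₂, a)`. -/
def GoodPair.IsAlpha (P : GoodPair.{u}) : Prop :=
  ∃ b₁ b₂ a : P.str.carrier, b₁ ≠ b₂ ∧ P.base = {b₁, b₂} ∧ P.baseᶜ = {a} ∧ P.str.rel b₁ b₂ a

/-- The admissible functions `μ` on isomorphism types of good pairs `(B, C)` in `KSp`: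
`μ(B, C) ≥ δ(B)` if `C` has at least two elements, and `μ(α) ≥ 1`. -/
def IsAdmissible (μ : GoodPairType.{u} → ℕ) : Prop :=
  ∀ P : GoodPair.{u},
    (2 ≤ (P.baseᶜ).ncard → P.str.delta P.base ≤ (μ P.type : ℤ)) ∧
    (P.IsAlpha → 1 ≤ μ P.type)

/-- The copies of `C` over `B` in `M`, where `B` is placed in `M` by `f`.
(There are none unless `f` is an embedding of the structure `B`.) -/
def copies (M : TernStr.{u}) (P : GoodPair.{u}) (f : P.base → M.carrier) :
    Set (Set M.carrier) :=
  {X | ∃ g : Emb P.str M, (∀ b : P.base, g.toFun b = f b) ∧ g.toFun '' P.baseᶜ = X}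

/-- The (maximal) number of pairwise disjoint copies of `C` over `B` in `M`. -/
noncomputable def chi (M : TernStr.{u}) (P : GoodPair.{u}) (f : P.base → M.carrier) : ℕ∞ :=
  ⨆ F ∈ {F : Set (Set M.carrier) | F ⊆ M.copies P f ∧ F.PairwiseDisjoint id}, F.encard

/-- The class of members of `KSp` that respect the bounds given by `μ`. -/
def KSpMu (μ : GoodPairType.{u} → ℕ) (M : TernStr.{u}) : Prop :=
  M.KSp ∧ ∀ (P : GoodPair.{u}) (f : P.base → M.carrier), M.chi P f ≤ (μ P.type : ℕ∞)

end TernStr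

namespace TernStr

/-! A four-point clique has predimension 2, so sparseness bounds lines by three points. Members of
the class are therefore finite partial triple systems, and `delta` counts points minus triples
(`KSp.isTripleSystem`, `IsTripleSystem.delta_eq`). This function is submodular, strictly so when a
triple crosses the two sets, and modular when none does.

Amalgamation without `μ`: if no line based in C is extended on both sides, the union of A and B over
C with no crossing triples is again a triple system. Modularity together with strength of C makes
both sides strong and keeps sparseness (`exists_strong_free_amalgam`). If a line based in C gains a
point a in A and b in B, then a and b must be identified. Adding such a point does not raise
`delta`, so C with a stays strong, and by strict submodularity a lies in no second triple with
points of C. Hence C enlarged by a and by b are isomorphic over C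
(`SharesExtendedLine.exists_extension`), and induction on |A| - |C| applies.

Amalgamation with `μ`: inserting an intermediate strong set reduces to the case where none lies
strictly between C and A. The free amalgam D then either respects `μ` or has too many disjoint
copies of some good pair. The latter forces the base into C, one copy equal to A \ C and another
inside B \ C (`IsFreeUnion.exists_twin`). In that case A embeds strongly in B over C, and B itself
is the amalgam. The count behind this is `KSp.encard_le_delta`: a base contained in neither A nor B
has at most `delta` of the base many disjoint copies, which the lower bound on `μ` allows. -/

variable {M N : TernStr.{u}}

/-! ### Triple systems and the sparse class -/

/-- Finite partial triple systems: any two distinct points lie in at most one triple. -/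
structure IsTripleSystem (M : TernStr.{u}) : Prop where
  finite : Finite M.carrier
  hyper : M.IsThreeHypergraph
  unique : ∀ {x y z w}, M.rel x y z → M.rel x y w → z = w

/-- The unordered related triples inside `S`. -/
def triples (M : TernStr.{u}) (S : Set M.carrier) : Set (Set M.carrier) :=
  {t | t ⊆ S ∧ ∃ x y z, M.rel x y z ∧ t = {x, y, z}}

theorem triples_mono {S T : Set M.carrier} (h : S ⊆ T) : M.triples S ⊆ M.triples T :=
  fun _ ht => ⟨ht.1.trans h, ht.2⟩

theorem triples_inter (S T : Set M.carrier) :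
    M.triples (S ∩ T) = M.triples S ∩ M.triples T := by
  ext t
  simp only [triples, Set.subset_inter_iff, Set.mem_ofPred_eq, Set.mem_inter_iff]
  tauto

theorem rel_mem_triples {S : Set M.carrier} {x y z : M.carrier} (h : M.rel x y z)
    (hx : x ∈ S) (hy : y ∈ S) (hz : z ∈ S) : {x, y, z} ∈ M.triples S :=
  ⟨by simp [Set.insert_subset_iff, hx, hy, hz], x, y, z, h, rfl⟩

theorem IsThreeHypergraph.swap (h : M.IsThreeHypergraph) {x y z : M.carrier}
    (r : M.rel x y z) : M.rel y x z := h.2.1 _ _ _ r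

theorem IsThreeHypergraph.swap_right (h : M.IsThreeHypergraph) {x y z : M.carrier}
    (r : M.rel x y z) : M.rel x z y := h.2.2 _ _ _ r

theorem IsThreeHypergraph.rotate (h : M.IsThreeHypergraph) {x y z : M.carrier}
    (r : M.rel x y z) : M.rel y z x := h.swap_right (h.swap r)

theorem IsThreeHypergraph.ncard_triple (h : M.IsThreeHypergraph) {S t : Set M.carrier}
    (ht : t ∈ M.triples S) : t.ncard = 3 := by
  obtain ⟨-, x, y, z, r, rfl⟩ := ht
  obtain ⟨h1, h2, h3⟩ := h.1 _ _ _ r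
  exact Set.ncard_eq_three.2 ⟨x, y, z, h1, h2, h3, rfl⟩

/-- A related triple can be listed starting with any two of its points. -/
theorem IsThreeHypergraph.exists_rel (h : M.IsThreeHypergraph) {S t : Set M.carrier}
    (ht : t ∈ M.triples S) {p q : M.carrier} (hp : p ∈ t) (hq : q ∈ t) (hpq : p ≠ q) :
    ∃ r, M.rel p q r ∧ t = {p, q, r} := by
  obtain ⟨-, x, y, z, r, rfl⟩ := ht
  simp only [Set.mem_insert_iff, Set.mem_singleton_iff] at hp hq
  rcases hp with rfl | rfl | rfl <;> rcases hq with rfl | rfl | rfl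
  · exact absurd rfl hpq
  · exact ⟨_, r, rfl⟩
  · exact ⟨_, h.swap_right r, by ext; simp; tauto⟩
  · exact ⟨_, h.swap r, by ext; simp; tauto⟩
  · exact absurd rfl hpq
  · exact ⟨_, h.rotate r, by ext; simp; tauto⟩
  · exact ⟨_, h.rotate (h.rotate r), by ext; simp; tauto⟩
  · exact ⟨_, h.swap (h.rotate r), by ext; simp; tauto⟩
  · exact absurd rfl hpq

theorem IsThreeHypergraph.isClique_triple (h : M.IsThreeHypergraph) {x y z : M.carrier}
    (r : M.rel x y z) : M.IsClique {x, y, z} := by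
  have ht := rel_mem_triples (S := Set.univ) r trivial trivial trivial
  intro a ha b hb c hc hab hac hbc
  obtain ⟨v, hv, e'⟩ := h.exists_rel ht ha hb hab
  rw [e'] at hc
  simp only [Set.mem_insert_iff, Set.mem_singleton_iff] at hc
  rcases hc with rfl | rfl | rfl
  · exact absurd rfl hac
  · exact absurd rfl hbc
  · exact hv

theorem IsTripleSystem.triple_eq (h : M.IsTripleSystem) {S T t t' : Set M.carrier}
    (ht : t ∈ M.triples S) (ht' : t' ∈ M.triples T) {p q : M.carrier} (hpq : p ≠ q)
    (hp : p ∈ t) (hq : q ∈ t) (hp' : p ∈ t') (hq' : q ∈ t') : t = t' := by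
  obtain ⟨r, hr, rfl⟩ := h.hyper.exists_rel ht hp hq hpq
  obtain ⟨r', hr', rfl⟩ := h.hyper.exists_rel ht' hp' hq' hpq
  rw [h.unique hr hr']

theorem IsTripleSystem.nontrivialLines_eq (h : M.IsTripleSystem) (S : Set M.carrier) :
    M.nontrivialLines S = M.triples S := by
  have := h.finite
  ext t
  constructor
  · rintro ⟨⟨⟨hS, hc⟩, -⟩, h3⟩
    obtain ⟨x, hx, y, hy, z, hz, h1, h2, h3⟩ := (Set.two_lt_ncard (s := t)).1 h3
    have r := hc x hx y hy z hz h1 h2 h3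
    refine ⟨hS, x, y, z, r, Set.Subset.antisymm (fun w hw => ?_) ?_⟩
    · by_cases hwx : x = w
      · simp [hwx]
      by_cases hwy : y = w
      · simp [hwy]
      simp [h.unique r (hc x hx y hy w hw h1 hwx hwy)]
    · simp [Set.insert_subset_iff, hx, hy, hz]
  · intro ht
    refine ⟨⟨⟨ht.1, ?_⟩, ?_⟩, (h.hyper.ncard_triple ht).ge⟩
    · intro x hx y hy z hz hxy hxz hyz
      obtain ⟨w, hw, rfl⟩ := h.hyper.exists_rel ht hx hy hxy
      simp only [Set.mem_insert_iff, Set.mem_singleton_iff] at hz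
      rcases hz with rfl | rfl | rfl
      · exact absurd rfl hxz
      · exact absurd rfl hyz
      · exact hw
    · rintro X ⟨-, hX⟩ htX w hw
      obtain ⟨-, x, y, z, r, rfl⟩ := ht
      have hx : x ∈ X := htX (by simp)
      have hy : y ∈ X := htX (by simp)
      by_cases hwx : x = w
      · simp [hwx]
      by_cases hwy : y = w
      · simp [hwy]
      simp [h.unique r (hX x hx y hy w hw (h.hyper.1 _ _ _ r).1 hwx hwy)]

theorem IsTripleSystem.delta_eq (h : M.IsTripleSystem) (S : Set M.carrier) :
    M.delta S = (S.ncard : ℤ) - ((M.triples S).ncard : ℤ) := by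
  have := h.finite
  rw [delta, h.nontrivialLines_eq, finsum_mem_eq_finite_toFinset_sum _ (Set.toFinite _),
    Set.ncard_eq_toFinset_card (M.triples S), Finset.sum_congr rfl (g := fun _ => (1 : ℤ))]
  · simp
  · intro t ht
    rw [h.hyper.ncard_triple ((Set.Finite.mem_toFinset _).1 ht)]
    norm_num

/-- The line through a and b consists of a, b and their third point, if there is one. -/
theorem IsTripleSystem.isLinearSpace (h : M.IsTripleSystem) : M.IsLinearSpace := by
  refine ⟨h.hyper, fun a b hab => ?_⟩
  have sub : ∀ X : Set M.carrier, M.IsClique X → a ∈ X → b ∈ X →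
      X ⊆ {a, b} ∪ {z | M.rel a b z} := by
    intro X hX ha hb w hw
    by_cases hwa : a = w
    · simp [hwa]
    by_cases hwb : b = w
    · simp [hwb]
    exact Or.inr (hX a ha b hb w hw hab hwa hwb)
  have clique : M.IsClique ({a, b} ∪ {z | M.rel a b z}) := by
    by_cases hz : ∃ z, M.rel a b z
    · obtain ⟨z, hz⟩ := hz
      have e : ({a, b} ∪ {z | M.rel a b z} : Set M.carrier) = {a, b, z} := by
        ext w
        simp only [Set.mem_union, Set.mem_insert_iff, Set.mem_singleton_iff, Set.mem_ofPred_eq]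
        constructor
        · rintro ((rfl | rfl) | hw)
          · simp
          · simp
          · simp [h.unique hz hw]
        · rintro (rfl | rfl | rfl) <;> simp [hz]
      rw [e]
      exact h.hyper.isClique_triple hz
    · have e : {z | M.rel a b z} = ∅ := by
        ext w; simpa using fun hw => hz ⟨w, hw⟩
      rw [e, Set.union_empty]
      intro x hx y hy w hw hxy hxw hyw
      simp only [Set.mem_insert_iff, Set.mem_singleton_iff] at hx hy hw
      rcases hx with rfl | rfl <;> rcases hy with rfl | rfl <;> rcases hw with rfl | rfl <;>
        contradiction
  refine ⟨{a, b} ∪ {z | M.rel a b z},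
    ⟨⟨⟨Set.subset_univ _, clique⟩, fun X hX hle => ?_⟩, by simp, by simp⟩, ?_⟩
  · exact sub X hX.2 (hle (by simp)) (hle (by simp))
  · rintro ℓ ⟨hℓ, ha, hb⟩
    exact hℓ.eq_of_subset ⟨Set.subset_univ _, clique⟩ (sub ℓ hℓ.prop.2 ha hb)

theorem exists_line [Finite M.carrier] {S : Set M.carrier} (hS : M.IsClique S) :
    ∃ ℓ, M.IsLineOf Set.univ ℓ ∧ S ⊆ ℓ := by
  obtain ⟨ℓ, h1, h2⟩ :=
    (Set.toFinite {X : Set M.carrier | X ⊆ Set.univ ∧ M.IsClique X}).exists_le_maximal (a := S) ⟨Set.subset_univ _, hS⟩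
  exact ⟨ℓ, h2, h1⟩

/-- Two third points z, w on the line through x, y would make {x, y, z, w} a clique, a four-point
space whose only line is itself; its predimension 4 - 2 = 2 is not above 2. -/
theorem KSp.isTripleSystem (h : M.KSp) : M.IsTripleSystem := by
  obtain ⟨hfin, ⟨hyp, hlin⟩, hs⟩ := h
  refine ⟨hfin, hyp, fun {x y z w} hz hw => ?_⟩
  by_contra hzw
  obtain ⟨hxy, hxz, hyz⟩ := hyp.1 _ _ _ hz
  obtain ⟨-, hxw, hyw⟩ := hyp.1 _ _ _ hw
  obtain ⟨ℓ₁, l1, s1⟩ := exists_line (hyp.isClique_triple hz)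
  obtain ⟨ℓ₂, l2, s2⟩ := exists_line (hyp.isClique_triple hw)
  have e : ℓ₁ = ℓ₂ := (hlin x y hxy).unique ⟨l1, s1 (by simp), s1 (by simp)⟩
    ⟨l2, s2 (by simp), s2 (by simp)⟩
  subst e
  have hsub : ({x, y, z, w} : Set M.carrier) ⊆ ℓ₁ := by
    simp only [Set.insert_subset_iff, Set.singleton_subset_iff]
    exact ⟨s1 (by simp), s1 (by simp), s1 (by simp), s2 (by simp)⟩
  have hcl : M.IsClique {x, y, z, w} := fun a ha b hb c hc =>
    l1.prop.2 a (hsub ha) b (hsub hb) c (hsub hc)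
  have hcard : ({x, y, z, w} : Set M.carrier).ncard = 4 := by
    rw [Set.ncard_insert_of_notMem (by simp [hxy, hxz, hxw]),
      Set.ncard_eq_three.2 ⟨y, z, w, hyz, hyw, hzw, rfl⟩]
  have hlines : M.nontrivialLines {x, y, z, w} = {{x, y, z, w}} := by
    ext t
    constructor
    · rintro ⟨ht, -⟩
      exact ht.eq_of_subset ⟨subset_rfl, hcl⟩ ht.prop.1
    · rintro rfl
      exact ⟨⟨⟨subset_rfl, hcl⟩, fun X hX _ => hX.1⟩, by rw [hcard]; norm_num⟩
  have hd : M.delta {x, y, z, w} = 2 := by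
    rw [delta, hlines, finsum_mem_singleton, hcard]
    norm_num
  have := (hs {x, y, z, w}).2 (by rw [hcard]; norm_num)
  omega

theorem IsTripleSystem.triples_eq_empty (h : M.IsTripleSystem) {S : Set M.carrier}
    (hS : S.ncard ≤ 2) : M.triples S = ∅ := by
  have := h.finite
  by_contra hne
  obtain ⟨t, ht⟩ := Set.nonempty_iff_ne_empty.2 hne
  have := h.hyper.ncard_triple ht
  have := Set.ncard_le_ncard ht.1
  omega

theorem IsTripleSystem.ncard_triples_le_one (h : M.IsTripleSystem) {S : Set M.carrier}
    (hS : S.ncard ≤ 4) : (M.triples S).ncard ≤ 1 := by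
  have := h.finite
  rw [Set.ncard_le_one_iff]
  intro t t' ht ht'
  by_contra hne
  have h1 := h.hyper.ncard_triple ht
  have h2 := h.hyper.ncard_triple ht'
  have h3 := Set.ncard_union_add_ncard_inter t t'
  have h4 := Set.ncard_le_ncard (Set.union_subset ht.1 ht'.1)
  obtain ⟨p, hp, q, hq, hpq⟩ := (Set.one_lt_ncard (s := t ∩ t')).1 (by omega)
  exact hne (h.triple_eq ht ht' hpq hp.1 hq.1 hp.2 hq.2)

/-- Only sets with more than three points need checking: two points carry no triple and three points
at most one, so `delta` is at least 2 there. -/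
theorem IsTripleSystem.ksp (h : M.IsTripleSystem)
    (hs : ∀ B : Set M.carrier, 3 < B.ncard → 2 < M.delta B) : M.KSp := by
  refine ⟨h.finite, h.isLinearSpace, fun B => ⟨fun hB => ?_, hs B⟩⟩
  rcases lt_or_ge 3 B.ncard with h3 | h3
  · have := hs B h3
    omega
  rw [h.delta_eq]
  rcases Nat.lt_or_ge 2 B.ncard with h2 | h2
  · have := h.ncard_triples_le_one (S := B) (by omega)
    omega
  · rw [h.triples_eq_empty h2]
    simpa using hB

theorem KSp.delta_nonneg (h : M.KSp) (S : Set M.carrier) : 0 ≤ M.delta S := by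
  rcases lt_or_ge 1 S.ncard with h1 | h1
  · have := (h.2.2 S).1 h1
    omega
  · rw [h.isTripleSystem.delta_eq, h.isTripleSystem.triples_eq_empty (by omega)]
    simp

/-! ### Submodularity and strong substructures -/

theorem IsTripleSystem.delta_submod (h : M.IsTripleSystem) (S T : Set M.carrier) :
    M.delta (S ∪ T) + M.delta (S ∩ T) ≤ M.delta S + M.delta T := by
  have := h.finite
  simp only [h.delta_eq, triples_inter]
  have h1 := Set.ncard_union_add_ncard_inter S T
  have h2 := Set.ncard_union_add_ncard_inter (M.triples S) (M.triples T)
  have h3 : (M.triples S ∪ M.triples T).ncard ≤ (M.triples (S ∪ T)).ncard :=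
    Set.ncard_le_ncard (Set.union_subset (triples_mono Set.subset_union_left)
      (triples_mono Set.subset_union_right))
  omega

/-- A crossing triple is counted in the union but in neither part. This gain of 1 drives every
rigidity and counting argument below. -/
theorem IsTripleSystem.delta_submod_lt (h : M.IsTripleSystem) {S T : Set M.carrier}
    {x y z : M.carrier} (r : M.rel x y z) (hx : x ∈ S ∪ T) (hy : y ∈ S ∪ T) (hz : z ∈ S ∪ T)
    (hS : ¬ {x, y, z} ⊆ S) (hT : ¬ {x, y, z} ⊆ T) :
    M.delta (S ∪ T) + M.delta (S ∩ T) < M.delta S + M.delta T := by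
  have := h.finite
  simp only [h.delta_eq, triples_inter]
  have h1 := Set.ncard_union_add_ncard_inter S T
  have h2 := Set.ncard_union_add_ncard_inter (M.triples S) (M.triples T)
  have h3 : M.triples S ∪ M.triples T ⊂ M.triples (S ∪ T) := by
    refine ⟨Set.union_subset (triples_mono Set.subset_union_left)
      (triples_mono Set.subset_union_right), fun hle => ?_⟩
    rcases hle (rel_mem_triples r hx hy hz) with h | h
    · exact hS h.1
    · exact hT h.1
  have h4 := Set.ncard_lt_ncard h3
  omega

theorem IsTripleSystem.delta_free (h : M.IsTripleSystem) {S T : Set M.carrier}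
    (hfree : ∀ x ∈ S ∪ T, ∀ y ∈ S ∪ T, ∀ z ∈ S ∪ T, M.rel x y z →
      {x, y, z} ⊆ S ∨ {x, y, z} ⊆ T) :
    M.delta (S ∪ T) + M.delta (S ∩ T) = M.delta S + M.delta T := by
  have := h.finite
  simp only [h.delta_eq, triples_inter]
  have h1 := Set.ncard_union_add_ncard_inter S T
  have h2 := Set.ncard_union_add_ncard_inter (M.triples S) (M.triples T)
  have h3 : M.triples (S ∪ T) = M.triples S ∪ M.triples T := by
    refine Set.Subset.antisymm ?_ (Set.union_subset (triples_mono Set.subset_union_left)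
      (triples_mono Set.subset_union_right))
    rintro t ⟨ht, x, y, z, r, rfl⟩
    exact (hfree x (ht (by simp)) y (ht (by simp)) z (ht (by simp)) r).imp
      (fun h => ⟨h, x, y, z, r, rfl⟩) (fun h => ⟨h, x, y, z, r, rfl⟩)
  rw [h3]
  omega

theorem IsTripleSystem.delta_insert_le (h : M.IsTripleSystem) {S : Set M.carrier}
    {x y a : M.carrier} (r : M.rel x y a) (hx : x ∈ S) (hy : y ∈ S) (ha : a ∉ S) :
    M.delta (insert a S) ≤ M.delta S := by
  have := h.finite
  simp only [h.delta_eq]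
  have h1 := Set.ncard_insert_of_notMem ha
  have h2 : M.triples S ⊂ M.triples (insert a S) := by
    refine ⟨triples_mono (Set.subset_insert _ _), fun hle => ?_⟩
    exact ha ((hle (rel_mem_triples r (Or.inr hx) (Or.inr hy) (Or.inl rfl))).1 (by simp))
  have h3 := Set.ncard_lt_ncard h2
  omega

/-- By submodularity for S and T ∩ W, since S ∪ (T ∩ W) lies between S and T. Transitivity of
strength follows from this. -/
theorem IsTripleSystem.strong_inter (h : M.IsTripleSystem) {S T : Set M.carrier}
    (hST : M.Strong S T) (W : Set M.carrier) : M.delta (S ∩ W) ≤ M.delta (T ∩ W) := by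
  have h1 := h.delta_submod S (T ∩ W)
  have h2 := hST.2 (S ∪ T ∩ W) Set.subset_union_left
    (Set.union_subset hST.1 Set.inter_subset_left)
  have e : S ∩ (T ∩ W) = S ∩ W := by
    rw [← Set.inter_assoc, Set.inter_eq_left.2 hST.1]
  rw [e] at h1
  omega

theorem Strong.mono {S T U : Set M.carrier} (h : M.Strong S U) (hST : S ⊆ T) (hTU : T ⊆ U) :
    M.Strong S T := ⟨hST, fun Z h1 h2 => h.2 Z h1 (h2.trans hTU)⟩

theorem Strong.of_delta_le {S T U : Set M.carrier} (h : M.Strong S U) (hST : S ⊆ T) (hTU : T ⊆ U)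
    (hd : M.delta T ≤ M.delta S) : M.Strong T U :=
  ⟨hTU, fun Z h1 h2 => hd.trans (h.2 Z (hST.trans h1) h2)⟩

theorem IsTripleSystem.strong_trans (h : M.IsTripleSystem) {S T U : Set M.carrier}
    (h1 : M.Strong S T) (h2 : M.Strong T U) : M.Strong S U := by
  refine ⟨h1.1.trans h2.1, fun Z hSZ hZU => ?_⟩
  have h3 := h.strong_inter h2 Z
  rw [Set.inter_eq_right.2 hZU] at h3
  exact (h1.2 _ (Set.subset_inter h1.1 hSZ) Set.inter_subset_left).trans h3

/-! ### Embeddings and induced substructures -/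

/-- The composite of two embeddings. -/
def Emb.comp {L M N : TernStr.{u}} (g : Emb M N) (f : Emb L M) : Emb L N where
  toFun := g.toFun ∘ f.toFun
  injective := g.injective.comp f.injective
  rel_iff _ _ _ := (g.rel_iff _ _ _).trans (f.rel_iff _ _ _)

/-- The identity embedding. -/
def Emb.refl (M : TernStr.{u}) : Emb M M := ⟨id, Function.injective_id, fun _ _ _ => Iff.rfl⟩

/-- The induced substructure with universe `S`. -/
def sub (M : TernStr.{u}) (S : Set M.carrier) : TernStr.{u} := ⟨S, fun x y z => M.rel x y z⟩

/-- The inclusion of an induced substructure. -/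
def subEmb (M : TernStr.{u}) (S : Set M.carrier) : Emb (M.sub S) M :=
  ⟨Subtype.val, Subtype.val_injective, fun _ _ _ => Iff.rfl⟩

theorem image_subEmb (S : Set M.carrier) : (M.subEmb S).image = S := Subtype.range_val

/-- An embedding whose image lies in the image of another one factors through it. -/
theorem Emb.exists_factor {P A D : TernStr.{u}} (g : Emb P D) (f : Emb A D)
    (h : g.image ⊆ f.image) : ∃ p : Emb P A, ∀ x, f.toFun (p.toFun x) = g.toFun x := by
  choose p hp using fun x => h ⟨x, rfl⟩
  refine ⟨⟨p, fun x y hxy => g.injective ?_, fun x y z => ?_⟩, hp⟩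
  · rw [← hp, ← hp, hxy]
  · rw [← f.rel_iff, hp, hp, hp, g.rel_iff]

theorem Emb.isTripleSystem (f : Emb M N) (h : N.IsTripleSystem) : M.IsTripleSystem := by
  have := h.finite
  refine ⟨Finite.of_injective _ f.injective, ⟨fun x y z r => ?_, fun x y z r => ?_,
    fun x y z r => ?_⟩, fun r r' => ?_⟩
  · obtain ⟨h1, h2, h3⟩ := h.hyper.1 _ _ _ ((f.rel_iff _ _ _).2 r)
    exact ⟨fun e => h1 (e ▸ rfl), fun e => h2 (e ▸ rfl), fun e => h3 (e ▸ rfl)⟩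
  · exact (f.rel_iff _ _ _).1 (h.hyper.swap ((f.rel_iff _ _ _).2 r))
  · exact (f.rel_iff _ _ _).1 (h.hyper.swap_right ((f.rel_iff _ _ _).2 r))
  · exact f.injective (h.unique ((f.rel_iff _ _ _).2 r) ((f.rel_iff _ _ _).2 r'))

theorem Emb.triples_image (f : Emb M N) (S : Set M.carrier) :
    N.triples (f.toFun '' S) = (fun t => f.toFun '' t) '' M.triples S := by
  ext t
  constructor
  · rintro ⟨ht, x, y, z, r, rfl⟩
    obtain ⟨a, ha, rfl⟩ := ht (by simp : x ∈ _)
    obtain ⟨b, hb, rfl⟩ := ht (by simp : y ∈ _)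
    obtain ⟨c, hc, rfl⟩ := ht (by simp : z ∈ _)
    exact ⟨_, rel_mem_triples ((f.rel_iff _ _ _).1 r) ha hb hc, by simp [Set.image_insert_eq]⟩
  · rintro ⟨_, ⟨ht, x, y, z, r, rfl⟩, rfl⟩
    exact ⟨Set.image_mono ht, _, _, _, (f.rel_iff _ _ _).2 r, by simp [Set.image_insert_eq]⟩

theorem Emb.delta_image (f : Emb M N) (h : N.IsTripleSystem) (S : Set M.carrier) :
    N.delta (f.toFun '' S) = M.delta S := by
  rw [h.delta_eq, (f.isTripleSystem h).delta_eq, f.triples_image,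
    Set.ncard_image_of_injective _ f.injective,
    Set.ncard_image_of_injective _ f.injective.image_injective]

theorem Emb.ksp (f : Emb M N) (h : N.KSp) : M.KSp := by
  refine (f.isTripleSystem h.isTripleSystem).ksp fun B hB => ?_
  rw [← f.delta_image h.isTripleSystem]
  exact (h.2.2 _).2 (by rwa [Set.ncard_image_of_injective _ f.injective])

theorem Emb.strong_image_iff (f : Emb M N) (h : N.IsTripleSystem) (S T : Set M.carrier) :
    N.Strong (f.toFun '' S) (f.toFun '' T) ↔ M.Strong S T := by
  constructor
  · rintro ⟨h1, h2⟩
    refine ⟨(Set.image_subset_image_iff f.injective).1 h1, fun Z hZ hZ' => ?_⟩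
    rw [← f.delta_image h, ← f.delta_image h]
    exact h2 _ (Set.image_mono hZ) (Set.image_mono hZ')
  · rintro ⟨h1, h2⟩
    refine ⟨Set.image_mono h1, fun Z hZ hZ' => ?_⟩
    obtain ⟨Z, hZT, rfl⟩ := Set.subset_image_iff.1 hZ'
    rw [f.delta_image h, f.delta_image h]
    exact h2 _ ((Set.image_subset_image_iff f.injective).1 hZ) hZT

theorem Emb.image_comp {L M N : TernStr.{u}} (g : Emb M N) (f : Emb L M) :
    (g.comp f).image = g.toFun '' f.image := Set.range_comp g.toFun f.toFun

theorem Emb.image_eq (f : Emb M N) : f.image = f.toFun '' Set.univ := Set.image_univ.symm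

theorem Emb.IsStrong.comp {L M N : TernStr.{u}} (h : N.IsTripleSystem) {g : Emb M N}
    {f : Emb L M} (hg : g.IsStrong) (hf : f.IsStrong) : (g.comp f).IsStrong := by
  refine h.strong_trans (T := g.image) ?_ hg
  rw [g.image_comp, g.image_eq]
  exact (g.strong_image_iff h _ _).2 hf

theorem Emb.isStrong_refl (M : TernStr.{u}) : (Emb.refl M).IsStrong := by
  have : (Emb.refl M).image = Set.univ := Set.range_id
  rw [Emb.IsStrong, this]
  exact ⟨subset_rfl, fun Z h _ => by rw [Set.univ_subset_iff.1 h]⟩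

theorem isStrong_subEmb {S : Set M.carrier} (h : M.Strong S Set.univ) :
    (M.subEmb S).IsStrong := by
  rwa [Emb.IsStrong, image_subEmb]

/-! ### Gluing embeddings and enlarging the base -/

/-- Two embeddings of one structure into `A` and `B`, freely placed over embeddings of `C`,
induce an embedding of `A` into `B` if they cover `A`. -/
theorem exists_emb_of_cover {A B C P : TernStr.{u}} (i : Emb C A) (j : Emb C B) (p : Emb P A)
    (q : Emb P B) (s : Set P.carrier) (hs : ∀ x ∈ s, ∃ c, i.toFun c = p.toFun x ∧
      j.toFun c = q.toFun x) (hp : ∀ x ∉ s, p.toFun x ∉ i.image) (hq : ∀ x ∉ s, q.toFun x ∉ j.image)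
    (hcov : i.image ∪ p.image = Set.univ)
    (hA : ∀ x y z, A.rel x y z → {x, y, z} ⊆ i.image ∨ {x, y, z} ⊆ p.image)
    (hB : ∀ x ∈ j.image ∪ q.image, ∀ y ∈ j.image ∪ q.image, ∀ z ∈ j.image ∪ q.image,
      B.rel x y z → {x, y, z} ⊆ j.image ∨ {x, y, z} ⊆ q.image) :
    ∃ h : Emb A B, (∀ c, h.toFun (i.toFun c) = j.toFun c) ∧
      ∀ x, h.toFun (p.toFun x) = q.toFun x := by
  have key : ∀ c x, i.toFun c = p.toFun x ↔ j.toFun c = q.toFun x := by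
    intro c x
    constructor
    · intro e
      have hx : x ∈ s := by
        by_contra hx
        exact hp x hx ⟨c, e⟩
      obtain ⟨c', h1, h2⟩ := hs x hx
      rw [i.injective (e.trans h1.symm), h2]
    · intro e
      have hx : x ∈ s := by
        by_contra hx
        exact hq x hx ⟨c, e⟩
      obtain ⟨c', h1, h2⟩ := hs x hx
      rw [j.injective (e.trans h2.symm), h1]
  -- The image of a is specified by having the same preimages under `j`, `q` as a has under `i`,
  -- `p`. This gives compatibility and injectivity at once.
  have hex : ∀ a, ∃ b, (∀ c, i.toFun c = a ↔ j.toFun c = b) ∧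
      (∀ x, p.toFun x = a ↔ q.toFun x = b) ∧ b ∈ j.image ∪ q.image := by
    intro a
    rcases (hcov ▸ Set.mem_univ a : a ∈ i.image ∪ p.image) with ⟨c, rfl⟩ | ⟨x, rfl⟩
    · exact ⟨j.toFun c, fun c' => i.injective.eq_iff.trans j.injective.eq_iff.symm,
        fun x => by rw [eq_comm, key, eq_comm], Or.inl ⟨c, rfl⟩⟩
    · exact ⟨q.toFun x, fun c => key c x,
        fun y => p.injective.eq_iff.trans q.injective.eq_iff.symm, Or.inr ⟨x, rfl⟩⟩
  choose h h1 h2 h3 using hex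
  have hi : ∀ c, h (i.toFun c) = j.toFun c := fun c => ((h1 _ c).1 rfl).symm
  have hq' : ∀ x, h (p.toFun x) = q.toFun x := fun x => ((h2 _ x).1 rfl).symm
  have hjm : ∀ a, h a ∈ j.image → a ∈ i.image := fun a ⟨c, hc⟩ => ⟨c, (h1 _ _).2 hc⟩
  have hqm : ∀ a, h a ∈ q.image → a ∈ p.image := fun a ⟨c, hc⟩ => ⟨c, (h2 _ _).2 hc⟩
  refine ⟨⟨h, fun a b hab => ?_, fun x y z => ?_⟩, hi, hq'⟩
  · rcases (hcov ▸ Set.mem_univ a : a ∈ i.image ∪ p.image) with ⟨c, rfl⟩ | ⟨x, rfl⟩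
    · exact (h1 b c).2 (by rw [← hab, hi])
    · exact (h2 b x).2 (by rw [← hab, hq'])
  · have hi3 : {x, y, z} ⊆ i.image → (B.rel (h x) (h y) (h z) ↔ A.rel x y z) := by
      intro hs
      obtain ⟨c, rfl⟩ := hs (by simp : x ∈ _)
      obtain ⟨d, rfl⟩ := hs (by simp : y ∈ _)
      obtain ⟨e, rfl⟩ := hs (by simp : z ∈ _)
      rw [hi, hi, hi, i.rel_iff, j.rel_iff]
    have hp3 : {x, y, z} ⊆ p.image → (B.rel (h x) (h y) (h z) ↔ A.rel x y z) := by
      intro hs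
      obtain ⟨c, rfl⟩ := hs (by simp : x ∈ _)
      obtain ⟨d, rfl⟩ := hs (by simp : y ∈ _)
      obtain ⟨e, rfl⟩ := hs (by simp : z ∈ _)
      rw [hq', hq', hq', p.rel_iff, q.rel_iff]
    constructor
    · intro r
      rcases hB _ (h3 x) _ (h3 y) _ (h3 z) r with hs | hs
      · refine (hi3 ?_).1 r
        rintro w (rfl | rfl | rfl) <;> exact hjm _ (hs (by simp))
      · refine (hp3 ?_).1 r
        rintro w (rfl | rfl | rfl) <;> exact hqm _ (hs (by simp))
    · intro r
      rcases hA _ _ _ r with hs | hs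
      · exact (hi3 hs).2 r
      · exact (hp3 hs).2 r

/-- If `E` has predimension `0` over `B` and over a strong set `Z ⊇ B`, then no triple relates
points of `E` to points of `Z \ B`. -/
theorem IsTripleSystem.rel_of_delta_union (h : M.IsTripleSystem) {Z U : Set M.carrier}
    (hZ : M.Strong Z Set.univ) (hU : M.delta U ≤ M.delta (Z ∩ U)) :
    ∀ x ∈ Z ∪ U, ∀ y ∈ Z ∪ U, ∀ z ∈ Z ∪ U, M.rel x y z → {x, y, z} ⊆ Z ∨ {x, y, z} ⊆ U := by
  intro x hx y hy z hz r
  by_contra hcon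
  rw [not_or] at hcon
  -- A crossing triple would push `delta (Z ∪ U)` below `delta Z`, against strength of Z.
  have h1 := h.delta_submod_lt r hx hy hz hcon.1 hcon.2
  have h2 := hZ.2 (Z ∪ U) Set.subset_union_left (Set.subset_univ _)
  omega

/-- There is a structure consisting of a single triple; it embeds onto every triple of a
3-hypergraph. -/
theorem exists_triangle : ∃ (T : TernStr.{u}) (t₀ t₁ t₂ : T.carrier),
    (∀ k, k = t₀ ∨ k = t₁ ∨ k = t₂) ∧
    ∀ (M : TernStr.{u}), M.IsThreeHypergraph → ∀ x y z, M.rel x y z →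
      ∃ e : Emb T M, e.toFun t₀ = x ∧ e.toFun t₁ = y ∧ e.toFun t₂ = z := by
  refine ⟨⟨ULift (Fin 3), fun x y z => x ≠ y ∧ x ≠ z ∧ y ≠ z⟩, ⟨0⟩, ⟨1⟩, ⟨2⟩, ?_, ?_⟩
  · rintro ⟨k⟩
    fin_cases k
    exacts [Or.inl rfl, Or.inr (Or.inl rfl), Or.inr (Or.inr rfl)]
  intro M h x y z r
  obtain ⟨h1, h2, h3⟩ := h.1 _ _ _ r
  have hinj : Function.Injective (fun k : ULift.{u} (Fin 3) => ![x, y, z] k.down) := by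
    rintro ⟨a⟩ ⟨b⟩ hab
    fin_cases a <;> fin_cases b <;> simp_all
  refine ⟨⟨fun k => ![x, y, z] k.down, hinj, fun a b c => ⟨fun r' => ?_, ?_⟩⟩, rfl, rfl, rfl⟩
  · obtain ⟨h1, h2, h3⟩ := h.1 _ _ _ r'
    exact ⟨fun e => h1 (e ▸ rfl), fun e => h2 (e ▸ rfl), fun e => h3 (e ▸ rfl)⟩
  · rintro ⟨hab, hac, hbc⟩
    have hmem : ∀ k : ULift.{u} (Fin 3), ![x, y, z] k.down ∈ ({x, y, z} : Set M.carrier) := by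
      rintro ⟨k⟩
      fin_cases k <;> simp
    exact h.isClique_triple r _ (hmem a) _ (hmem b) _ (hmem c) (hinj.ne hab) (hinj.ne hac)
      (hinj.ne hbc)

/-- A common extension of a based line can be added to the base of an amalgamation problem. -/
theorem SharesExtendedLine.exists_extension {A B C : TernStr.{u}} (hA : A.IsTripleSystem)
    (hB : B.IsTripleSystem) {i : Emb C A} {j : Emb C B} (hi : i.IsStrong) (hj : j.IsStrong)
    (hs : SharesExtendedLine i j) :
    ∃ (C' : TernStr.{u}) (k : Emb C C') (i' : Emb C' A) (j' : Emb C' B),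
      (∀ c, i'.toFun (k.toFun c) = i.toFun c) ∧ (∀ c, j'.toFun (k.toFun c) = j.toFun c) ∧
      i'.IsStrong ∧ j'.IsStrong ∧ Nat.card C.carrier < Nat.card C'.carrier := by
  obtain ⟨c₁, c₂, -, ⟨a, ha, ra⟩, b, hb, rb⟩ := hs
  have hfin := hA.finite
  have hstrong : ∀ {N : TernStr.{u}} (hN : N.IsTripleSystem) {l : Emb C N} (hl : l.IsStrong)
      {d : N.carrier} (hd : d ∉ l.image) (rd : N.rel (l.toFun c₁) (l.toFun c₂) d),
      N.Strong (insert d l.image) Set.univ := fun hN l hl d hd rd =>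
    hl.of_delta_le (Set.subset_insert _ _) (Set.subset_univ _)
      (hN.delta_insert_le rd ⟨_, rfl⟩ ⟨_, rfl⟩ hd)
  have htri : ∀ {N : TernStr.{u}} (hN : N.IsTripleSystem) {l : Emb C N} (hl : l.IsStrong)
      {d : N.carrier} (hd : d ∉ l.image) (rd : N.rel (l.toFun c₁) (l.toFun c₂) d)
      (x y z), x ∈ insert d l.image → y ∈ insert d l.image → z ∈ insert d l.image →
        N.rel x y z → {x, y, z} ⊆ l.image ∨
          ({x, y, z} : Set N.carrier) ⊆ {l.toFun c₁, l.toFun c₂, d} := by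
    intro N hN l hl d hd rd x y z hx hy hz r
    have e1 : ({l.toFun c₁, l.toFun c₂, d} : Set N.carrier) =
        insert d {l.toFun c₁, l.toFun c₂} := by
      ext; simp; tauto
    have e2 : l.image ∩ {l.toFun c₁, l.toFun c₂, d} = {l.toFun c₁, l.toFun c₂} := by
      ext w
      simp only [Set.mem_inter_iff, Set.mem_insert_iff, Set.mem_singleton_iff]
      constructor
      · rintro ⟨h1, h2 | h2 | rfl⟩
        · exact Or.inl h2
        · exact Or.inr h2
        · exact absurd h1 hd
      · rintro (rfl | rfl)
        · exact ⟨⟨_, rfl⟩, by simp⟩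
        · exact ⟨⟨_, rfl⟩, by simp⟩
    have hmem : ∀ w ∈ insert d l.image, w ∈ l.image ∪ {l.toFun c₁, l.toFun c₂, d} := by
      rintro w (rfl | hw)
      · exact Or.inr (by simp)
      · exact Or.inl hw
    -- The triple on the extended line has predimension at most that of its two base points, so no
    -- other triple joins the new point to the base.
    refine hN.rel_of_delta_union hl ?_ x (hmem x hx) y (hmem y hy) z (hmem z hz) r
    rw [e2, e1]
    refine hN.delta_insert_le rd (by simp) (by simp) ?_
    rintro (rfl | rfl) <;> exact hd ⟨_, rfl⟩
  obtain ⟨T, t₀, t₁, t₂, hT, htriangle⟩ := exists_triangle.{u}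
  have himg : ∀ {N : TernStr.{u}} (e : Emb T N), e.image =
      {e.toFun t₀, e.toFun t₁, e.toFun t₂} := by
    intro N e
    ext w
    constructor
    · rintro ⟨k, rfl⟩
      rcases hT k with rfl | rfl | rfl <;> simp
    · rintro (rfl | rfl | rfl) <;> exact ⟨_, rfl⟩
  -- The new base is realised inside A as the image of C together with a. Its map to B is glued from
  -- `j` and the triangle sent onto the triple ending in b.
  obtain ⟨k, hk⟩ := i.exists_factor (A.subEmb (insert a i.image)) (by
    rw [image_subEmb]; exact Set.subset_insert _ _)
  obtain ⟨p, hp0, hp1, hp2⟩ := htriangle A hA.hyper _ _ _ ra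
  have hpi : p.image = {i.toFun c₁, i.toFun c₂, a} := by rw [himg, hp0, hp1, hp2]
  obtain ⟨p', hp'⟩ := p.exists_factor (A.subEmb (insert a i.image)) (by
    rw [image_subEmb, hpi]
    rintro w (rfl | rfl | rfl)
    · exact Or.inr ⟨_, rfl⟩
    · exact Or.inr ⟨_, rfl⟩
    · exact Or.inl rfl)
  obtain ⟨q, hq0, hq1, hq2⟩ := htriangle B hB.hyper _ _ _ rb
  have hkim : ∀ w, w ∈ k.image ↔ (A.subEmb (insert a i.image)).toFun w ∈ i.image := by
    intro w
    constructor
    · rintro ⟨c, rfl⟩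
      exact ⟨c, (hk c).symm⟩
    · rintro ⟨c, hc⟩
      exact ⟨c, (A.subEmb _).injective ((hk c).trans hc)⟩
  have hpim : ∀ w, w ∈ p'.image ↔ (A.subEmb (insert a i.image)).toFun w ∈ p.image := by
    intro w
    constructor
    · rintro ⟨c, rfl⟩
      exact ⟨c, (hp' c).symm⟩
    · rintro ⟨c, hc⟩
      exact ⟨c, (A.subEmb _).injective ((hp' c).trans hc)⟩
  have hqimage : j.image ∪ q.image = insert b j.image := by
    rw [himg, hq0, hq1, hq2]
    ext w
    simp only [Set.mem_union, Set.mem_insert_iff, Set.mem_singleton_iff]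
    constructor
    · rintro (h | rfl | rfl | h)
      · exact Or.inr h
      · exact Or.inr ⟨_, rfl⟩
      · exact Or.inr ⟨_, rfl⟩
      · exact Or.inl h
    · tauto
  obtain ⟨j', hj1, hj2⟩ := exists_emb_of_cover k j p' q {t₀, t₁}
    (by
      rintro x (rfl | rfl)
      · exact ⟨c₁, (A.subEmb _).injective (by rw [hk, hp', hp0]), hq0.symm⟩
      · exact ⟨c₂, (A.subEmb _).injective (by rw [hk, hp', hp1]), hq1.symm⟩)
    (by
      intro x hx
      rcases hT x with rfl | rfl | rfl
      · simp at hx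
      · simp at hx
      · rw [hkim, hp', hp2]; exact ha)
    (by
      intro x hx
      rcases hT x with rfl | rfl | rfl
      · simp at hx
      · simp at hx
      · rw [hq2]; exact hb)
    (by
      refine Set.eq_univ_of_forall fun w => ?_
      rcases w.2 with h | h
      · refine Or.inr ((hpim w).2 ⟨t₂, hp2.trans h.symm⟩)
      · exact Or.inl ((hkim w).2 h))
    (by
      intro x y z r
      have hset : ∀ V : Set A.carrier, ∀ U : Set (A.sub (insert a i.image)).carrier,
          (∀ w, w ∈ U ↔ (A.subEmb (insert a i.image)).toFun w ∈ V) →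
          ({(A.subEmb (insert a i.image)).toFun x, (A.subEmb (insert a i.image)).toFun y,
            (A.subEmb (insert a i.image)).toFun z} ⊆ V) → {x, y, z} ⊆ U := by
        rintro V U hTU hV w (rfl | rfl | rfl) <;> exact (hTU _).2 (hV (by simp))
      exact (htri hA hi ha ra _ _ _ x.2 y.2 z.2 r).imp (hset _ _ hkim)
        (fun h => hset _ _ hpim (h.trans hpi.ge)))
    (by
      rw [hqimage]
      intro x hx y hy z hz r
      rw [himg, hq0, hq1, hq2]
      exact htri hB hj hb rb x y z hx hy hz r)
  refine ⟨_, k, A.subEmb _, j', hk, hj1, isStrong_subEmb (hstrong hA hi ha ra), ?_, ?_⟩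
  · have e : j'.image = insert b j.image := by
      ext w
      constructor
      · rintro ⟨x, rfl⟩
        rcases x.2 with h | h
        · left
          have : x = p'.toFun t₂ := (A.subEmb _).injective (by rw [hp', hp2]; exact h)
          rw [this, hj2, hq2]
        · right
          obtain ⟨c, rfl⟩ := (hkim x).2 h
          exact ⟨c, (hj1 c).symm⟩
      · rintro (rfl | ⟨c, rfl⟩)
        · exact ⟨_, (hj2 _).trans hq2⟩
        · exact ⟨_, hj1 c⟩
    rw [Emb.IsStrong, e]
    exact hstrong hB hj hb rb
  · have h1 : Nat.card C.carrier = i.image.ncard := (Nat.card_range_of_injective i.injective).symm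
    rw [h1]
    exact Set.ncard_lt_ncard (Set.ssubset_insert ha)

/-! ### Free amalgams -/

/-- The union of `X` and `Y`, with no triple that is neither inside `X` nor inside `Y`. -/
def IsFreeUnion (D : TernStr.{u}) (X Y : Set D.carrier) : Prop :=
  X ∪ Y = Set.univ ∧ ∀ x y z, D.rel x y z → {x, y, z} ⊆ X ∨ {x, y, z} ⊆ Y

theorem IsFreeUnion.delta {D : TernStr.{u}} {X Y : Set D.carrier} (h : D.IsFreeUnion X Y)
    (hD : D.IsTripleSystem) (W : Set D.carrier) :
    D.delta W + D.delta (X ∩ Y ∩ W) = D.delta (X ∩ W) + D.delta (Y ∩ W) := by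
  have e1 : (X ∩ W) ∪ (Y ∩ W) = W := by
    rw [← Set.union_inter_distrib_right, h.1, Set.univ_inter]
  have e2 : (X ∩ W) ∩ (Y ∩ W) = X ∩ Y ∩ W := by
    ext; simp; tauto
  have := hD.delta_free (S := X ∩ W) (T := Y ∩ W) (by
    rw [e1]
    intro x hx y hy z hz r
    have hW : ({x, y, z} : Set D.carrier) ⊆ W := by
      rintro w (rfl | rfl | rfl) <;> assumption
    exact (h.2 x y z r).imp (fun h => Set.subset_inter h hW) (fun h => Set.subset_inter h hW))
  rwa [e1, e2] at this

theorem IsFreeUnion.symm {D : TernStr.{u}} {X Y : Set D.carrier} (h : D.IsFreeUnion X Y) :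
    D.IsFreeUnion Y X :=
  ⟨by rw [Set.union_comm, h.1], fun x y z r => (h.2 x y z r).symm⟩

theorem IsFreeUnion.strong {D : TernStr.{u}} {X Y : Set D.carrier} (h : D.IsFreeUnion X Y)
    (hD : D.IsTripleSystem) (hY : D.Strong (X ∩ Y) Y) : D.Strong X Set.univ := by
  refine ⟨Set.subset_univ _, fun W hXW _ => ?_⟩
  have h1 := h.delta hD W
  have h2 := hD.strong_inter hY W
  rw [Set.inter_eq_left.2 hXW] at h1
  omega

/-- By modularity and strength of X ∩ Y, `delta W` is at least that of each of its traces on X and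
Y, so a trace with more than three points suffices. Otherwise each trace carries at most one triple.
-/
theorem IsFreeUnion.ksp {D : TernStr.{u}} {X Y : Set D.carrier} (h : D.IsFreeUnion X Y)
    (hD : D.IsTripleSystem) (hX : D.Strong (X ∩ Y) X) (hY : D.Strong (X ∩ Y) Y)
    (sX : ∀ B ⊆ X, 3 < B.ncard → 2 < D.delta B) (sY : ∀ B ⊆ Y, 3 < B.ncard → 2 < D.delta B) :
    D.KSp := by
  have := hD.finite
  refine hD.ksp fun W hW => ?_
  have h1 := h.delta hD W
  have h2 := hD.strong_inter hX W
  have h3 := hD.strong_inter hY W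
  rcases lt_or_ge 3 (X ∩ W).ncard with h4 | h4
  · have := sX _ Set.inter_subset_left h4
    omega
  rcases lt_or_ge 3 (Y ∩ W).ncard with h5 | h5
  · have := sY _ Set.inter_subset_left h5
    omega
  rw [hD.delta_eq]
  -- At least five points with at most two triples, or four points with at most one: `delta` is at
  -- least 3 either way.
  rcases lt_or_ge 4 W.ncard with h6 | h6
  · have h7 : D.triples W ⊆ D.triples (X ∩ W) ∪ D.triples (Y ∩ W) := by
      rintro t ⟨ht, x, y, z, r, rfl⟩
      exact (h.2 x y z r).imp (fun h => ⟨Set.subset_inter h ht, x, y, z, r, rfl⟩)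
        (fun h => ⟨Set.subset_inter h ht, x, y, z, r, rfl⟩)
    have h8 := Set.ncard_le_ncard h7
    have h9 := Set.ncard_union_le (D.triples (X ∩ W)) (D.triples (Y ∩ W))
    have h10 := hD.ncard_triples_le_one (S := X ∩ W) (by omega)
    have h11 := hD.ncard_triples_le_one (S := Y ∩ W) (by omega)
    omega
  · have := hD.ncard_triples_le_one h6
    omega

/-- The free amalgam of two triple systems over a common subsystem. -/
theorem exists_free_amalgam {A B C : TernStr.{u}} (hA : A.IsTripleSystem) (hB : B.IsTripleSystem)
    (i : Emb C A) (j : Emb C B) (hs : ¬ SharesExtendedLine i j) :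
    ∃ (D : TernStr.{u}) (f : Emb A D) (g : Emb B D), D.IsTripleSystem ∧
      (∀ c, f.toFun (i.toFun c) = g.toFun (j.toFun c)) ∧ D.IsFreeUnion f.image g.image ∧
      f.image ∩ g.image = Set.range (fun c => f.toFun (i.toFun c)) := by
  classical
  let E := A.carrier ⊕ {b : B.carrier // b ∉ j.image}
  have := hA.finite
  have := hB.finite
  let f : A.carrier → E := Sum.inl
  have hg : ∀ b, ∃ e : E, (∀ c, j.toFun c = b → e = f (i.toFun c)) ∧
      ∀ h : b ∉ j.image, e = Sum.inr ⟨b, h⟩ := by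
    intro b
    by_cases hb : b ∈ j.image
    · obtain ⟨c, rfl⟩ := hb
      exact ⟨f (i.toFun c), fun c' hc' => by rw [j.injective hc'], fun h => absurd ⟨c, rfl⟩ h⟩
    · exact ⟨Sum.inr ⟨b, hb⟩, fun c hc => absurd ⟨c, hc⟩ hb, fun _ => rfl⟩
  choose g hg1 hg2 using hg
  have hgj : ∀ c, g (j.toFun c) = f (i.toFun c) := fun c => hg1 _ c rfl
  have hf : Function.Injective f := Sum.inl_injective
  have hfg : ∀ a b, f a = g b → ∃ c, i.toFun c = a ∧ j.toFun c = b := by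
    intro a b hab
    by_cases hb : b ∈ j.image
    · obtain ⟨c, rfl⟩ := hb
      rw [hgj] at hab
      exact ⟨c, (hf hab).symm, rfl⟩
    · rw [hg2 b hb] at hab
      cases hab
  have hginj : Function.Injective g := by
    intro b b' hbb
    by_cases hb : b ∈ j.image
    · obtain ⟨c, rfl⟩ := hb
      rw [hgj] at hbb
      obtain ⟨c', h1, h2⟩ := hfg _ _ hbb
      rw [← i.injective h1, h2]
    · by_cases hb' : b' ∈ j.image
      · obtain ⟨c, rfl⟩ := hb'
        rw [hgj] at hbb
        obtain ⟨c', h1, h2⟩ := hfg _ _ hbb.symm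
        rw [← i.injective h1, h2]
      · rw [hg2 b hb, hg2 b' hb'] at hbb
        exact congrArg Subtype.val (Sum.inr_injective hbb)
  let D : TernStr.{u} := ⟨E, fun x y z =>
    (∃ a b c, A.rel a b c ∧ x = f a ∧ y = f b ∧ z = f c) ∨
    (∃ a b c, B.rel a b c ∧ x = g a ∧ y = g b ∧ z = g c)⟩
  have hfrel : ∀ a b c, D.rel (f a) (f b) (f c) ↔ A.rel a b c := by
    intro a b c
    constructor
    · rintro (⟨a', b', c', r, h1, h2, h3⟩ | ⟨a', b', c', r, h1, h2, h3⟩)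
      · rwa [hf h1, hf h2, hf h3]
      · obtain ⟨c1, rfl, rfl⟩ := hfg _ _ h1
        obtain ⟨c2, rfl, rfl⟩ := hfg _ _ h2
        obtain ⟨c3, rfl, rfl⟩ := hfg _ _ h3
        rwa [i.rel_iff, ← j.rel_iff]
    · intro r
      exact Or.inl ⟨a, b, c, r, rfl, rfl, rfl⟩
  have hgrel : ∀ a b c, D.rel (g a) (g b) (g c) ↔ B.rel a b c := by
    intro a b c
    constructor
    · rintro (⟨a', b', c', r, h1, h2, h3⟩ | ⟨a', b', c', r, h1, h2, h3⟩)
      · obtain ⟨c1, rfl, rfl⟩ := hfg _ _ h1.symm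
        obtain ⟨c2, rfl, rfl⟩ := hfg _ _ h2.symm
        obtain ⟨c3, rfl, rfl⟩ := hfg _ _ h3.symm
        rwa [j.rel_iff, ← i.rel_iff]
      · rwa [hginj h1, hginj h2, hginj h3]
    · intro r
      exact Or.inr ⟨a, b, c, r, rfl, rfl, rfl⟩
  -- Uniqueness of third points across the two sides; the only place where the absence of a doubly
  -- extended line is needed.
  have hcross : ∀ a b x a' b' y, A.rel a b x → B.rel a' b' y → f a = g a' → f b = g b' →
      f x = g y := by
    intro a b x a' b' y r r' h1 h2
    obtain ⟨c1, rfl, rfl⟩ := hfg _ _ h1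
    obtain ⟨c2, rfl, rfl⟩ := hfg _ _ h2
    by_cases hx : x ∈ i.image
    · obtain ⟨c3, rfl⟩ := hx
      rw [hB.unique r' ((j.rel_iff _ _ _).2 ((i.rel_iff _ _ _).1 r)), hgj]
    by_cases hy : y ∈ j.image
    · obtain ⟨c3, rfl⟩ := hy
      rw [hA.unique r ((i.rel_iff _ _ _).2 ((j.rel_iff _ _ _).1 r')), hgj]
    exact absurd ⟨c1, c2, fun e => (hA.hyper.1 _ _ _ r).1 (e ▸ rfl), ⟨x, hx, r⟩, y, hy, r'⟩ hs
  let F : Emb A D := ⟨f, hf, hfrel⟩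
  let G : Emb B D := ⟨g, hginj, hgrel⟩
  refine ⟨D, F, G, ⟨inferInstanceAs (Finite E), ⟨?_, ?_, ?_⟩, ?_⟩, fun c => (hgj c).symm,
    ⟨?_, ?_⟩, ?_⟩
  · rintro x y z (⟨a, b, c, r, rfl, rfl, rfl⟩ | ⟨a, b, c, r, rfl, rfl, rfl⟩)
    · obtain ⟨h1, h2, h3⟩ := hA.hyper.1 _ _ _ r
      exact ⟨hf.ne h1, hf.ne h2, hf.ne h3⟩
    · obtain ⟨h1, h2, h3⟩ := hB.hyper.1 _ _ _ r
      exact ⟨hginj.ne h1, hginj.ne h2, hginj.ne h3⟩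
  · rintro x y z (⟨a, b, c, r, rfl, rfl, rfl⟩ | ⟨a, b, c, r, rfl, rfl, rfl⟩)
    · exact (hfrel _ _ _).2 (hA.hyper.swap r)
    · exact (hgrel _ _ _).2 (hB.hyper.swap r)
  · rintro x y z (⟨a, b, c, r, rfl, rfl, rfl⟩ | ⟨a, b, c, r, rfl, rfl, rfl⟩)
    · exact (hfrel _ _ _).2 (hA.hyper.swap_right r)
    · exact (hgrel _ _ _).2 (hB.hyper.swap_right r)
  · rintro x y z w (⟨a, b, c, r, rfl, rfl, rfl⟩ | ⟨a, b, c, r, rfl, rfl, rfl⟩)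
      (⟨a', b', c', r', h1, h2, rfl⟩ | ⟨a', b', c', r', h1, h2, rfl⟩)
    · rw [← hf h1, ← hf h2] at r'
      rw [hA.unique r r']
    · exact hcross _ _ _ _ _ _ r r' h1 h2
    · exact (hcross _ _ _ _ _ _ r' r h1.symm h2.symm).symm
    · rw [← hginj h1, ← hginj h2] at r'
      rw [hB.unique r r']
  · refine Set.eq_univ_of_forall ?_
    rintro (a | ⟨b, hb⟩)
    · exact Or.inl ⟨a, rfl⟩
    · exact Or.inr ⟨b, hg2 b hb⟩
  · rintro x y z (⟨a, b, c, r, rfl, rfl, rfl⟩ | ⟨a, b, c, r, rfl, rfl, rfl⟩)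
    · left
      rintro w (rfl | rfl | rfl) <;> exact ⟨_, rfl⟩
    · right
      rintro w (rfl | rfl | rfl) <;> exact ⟨_, rfl⟩
  · ext x
    constructor
    · rintro ⟨⟨a, rfl⟩, b, hb⟩
      obtain ⟨c, rfl, -⟩ := hfg a b hb.symm
      exact ⟨c, rfl⟩
    · rintro ⟨c, rfl⟩
      exact ⟨⟨_, rfl⟩, _, hgj c⟩

/-- Both sides of the equivalence fail: no triple crosses, and a line based in X ∩ Y has only one
further point, which cannot be both a and b. -/
theorem IsFreeUnion.isFreeAmalgam {D : TernStr.{u}} {X Y : Set D.carrier}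
    (h : D.IsFreeUnion X Y) (hD : D.IsTripleSystem) : D.IsFreeAmalgam X Y := by
  refine ⟨h.1, fun a ha b hb => iff_of_false ?_ ?_⟩
  · rintro ⟨d, r⟩
    rcases h.2 _ _ _ r with h | h
    · exact hb.2 (h (by simp))
    · exact ha.2 (h (by simp))
  · rintro ⟨c₁, -, c₂, -, -, r, r'⟩
    exact ha.2 (hD.unique r r' ▸ hb.1)

/-- The free amalgam of strong extensions in `KSp` which share no extended line. -/
theorem exists_strong_free_amalgam {A B C : TernStr.{u}} (hA : A.KSp) (hB : B.KSp)
    {i : Emb C A} {j : Emb C B} (hi : i.IsStrong) (hj : j.IsStrong)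
    (hs : ¬ SharesExtendedLine i j) :
    ∃ (D : TernStr.{u}) (f : Emb A D) (g : Emb B D), D.KSp ∧ f.IsStrong ∧ g.IsStrong ∧
      (∀ c, f.toFun (i.toFun c) = g.toFun (j.toFun c)) ∧ D.IsFreeUnion f.image g.image ∧
      f.image ∩ g.image = Set.range (fun c => f.toFun (i.toFun c)) := by
  obtain ⟨D, f, g, hD, hfg, hfree, hint⟩ :=
    exists_free_amalgam hA.isTripleSystem hB.isTripleSystem i j hs
  have hX : D.Strong (f.image ∩ g.image) f.image := by
    have e : f.image ∩ g.image = f.toFun '' i.image := by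
      rw [hint, ← f.image_comp]; rfl
    rw [e, f.image_eq]
    exact (f.strong_image_iff hD _ _).2 hi
  have hY : D.Strong (f.image ∩ g.image) g.image := by
    have e : f.image ∩ g.image = g.toFun '' j.image := by
      rw [hint, ← g.image_comp]
      exact congrArg Set.range (funext hfg)
    rw [e, g.image_eq]
    exact (g.strong_image_iff hD _ _).2 hj
  have sparse : ∀ {N : TernStr.{u}} (hN : N.KSp) (l : Emb N D), ∀ B ⊆ l.image,
      3 < B.ncard → 2 < D.delta B := by
    intro N hN l B hB h3
    obtain ⟨B, -, rfl⟩ := Set.subset_image_iff.1 (l.image_eq ▸ hB)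
    rw [l.delta_image hD]
    rw [Set.ncard_image_of_injective _ l.injective] at h3
    exact (hN.2.2 B).2 h3
  exact ⟨D, f, g, hfree.ksp hD hX hY (sparse hA f) (sparse hB g), hfree.strong hD hY,
    hfree.symm.strong hD (Set.inter_comm _ _ ▸ hX), hfg, hfree, hint⟩

theorem exists_isFreeAmalgam (n : ℕ) : ∀ (A B C : TernStr.{u}), A.KSp → B.KSp →
    ∀ (i : Emb C A) (j : Emb C B), i.IsStrong → j.IsStrong →
      Nat.card A.carrier - Nat.card C.carrier = n →
      ∃ (D : TernStr.{u}) (f : Emb A D) (g : Emb B D), D.KSp ∧ f.IsStrong ∧ g.IsStrong ∧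
        (∀ c, f.toFun (i.toFun c) = g.toFun (j.toFun c)) ∧ D.IsFreeAmalgam f.image g.image ∧
        (¬ SharesExtendedLine i j →
          f.image ∩ g.image = Set.range (fun c => f.toFun (i.toFun c))) := by
  induction n using Nat.strong_induction_on with
  | _ n ih =>
    intro A B C hA hB i j hi hj hn
    by_cases hs : SharesExtendedLine i j
    · obtain ⟨C', k, i', j', hk1, hk2, hi', hj', hlt⟩ :=
        hs.exists_extension hA.isTripleSystem hB.isTripleSystem hi hj
      have := hA.1
      have := Nat.card_le_card_of_injective _ i'.injective
      obtain ⟨D, f, g, hD, hf, hg, hfg, hfree, -⟩ :=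
        ih _ (by omega) A B C' hA hB i' j' hi' hj' rfl
      exact ⟨D, f, g, hD, hf, hg, fun c => by rw [← hk1, ← hk2, hfg], hfree, fun h => absurd hs h⟩
    · obtain ⟨D, f, g, hD, hf, hg, hfg, hfree, hint⟩ := exists_strong_free_amalgam hA hB hi hj hs
      exact ⟨D, f, g, hD, hf, hg, hfg, hfree.isFreeAmalgam hD.isTripleSystem, fun _ => hint⟩

/-! ### Primitive and good pairs -/

theorem isZeroPrimitive_iff {B C : Set M.carrier} : M.IsZeroPrimitive C B ↔
    C.Nonempty ∧ Disjoint C B ∧ M.delta (B ∪ C) = M.delta B ∧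
      ∀ Y, B ⊂ Y → Y ⊂ B ∪ C → M.delta B < M.delta Y := by
  constructor
  · rintro ⟨h1, h2, h3, h4, h5⟩
    refine ⟨h1, h2, by omega, fun Y hY hY' => ?_⟩
    have h6 := h3.2 Y hY.1 hY'.1
    by_contra h7
    exact h4 ⟨Y, hY, hY', h3.mono hY.1 hY'.1, h3.of_delta_le hY.1 hY'.1 (by omega)⟩
  · rintro ⟨h1, h2, h3, h4⟩
    refine ⟨h1, h2, ⟨Set.subset_union_left, fun Z hZ hZ' => ?_⟩, ?_, by omega⟩
    · rcases Set.eq_or_ssubset_of_subset hZ with rfl | hZ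
      · exact le_rfl
      rcases Set.eq_or_ssubset_of_subset hZ' with rfl | hZ'
      · exact h3.ge
      · exact (h4 Z hZ hZ').le
    · rintro ⟨X, hX, hX', -, hs⟩
      have := h4 X hX hX'
      have := hs.2 _ hX'.1 subset_rfl
      omega

/-- `E` is `0`-primitive over `B`, and every point of `B` is related to a point of `E`. -/
structure IsTight (M : TernStr.{u}) (E B : Set M.carrier) : Prop where
  disjoint : Disjoint E B
  delta_eq : M.delta (B ∪ E) = M.delta B
  delta_lt : ∀ Y, B ⊂ Y → Y ⊂ B ∪ E → M.delta B < M.delta Y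
  exists_rel : ∀ b ∈ B, ∃ e ∈ E, ∃ z ∈ B ∪ E, M.rel b e z

/-- If a base point b were in no triple with E, deleting it would shift `delta` of all sets between
B and B ∪ E by the same amount, and E would already be 0-primitive over B \ {b}. -/
theorem IsGood.isTight (hM : M.IsTripleSystem) {E B : Set M.carrier} (h : M.IsGood E B) :
    M.IsTight E B := by
  obtain ⟨hne, hdisj, heq, hlt⟩ := isZeroPrimitive_iff.1 h.1
  refine ⟨hdisj, heq, hlt, fun b hb => ?_⟩
  by_contra hcon
  push Not at hcon
  have hbE : b ∉ E := fun hbE => Set.disjoint_left.1 hdisj hbE hb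
  have key : ∀ Y, B \ {b} ⊆ Y → Y ⊆ B \ {b} ∪ E →
      M.delta (insert b Y) + M.delta (B \ {b}) = M.delta Y + M.delta B := by
    intro Y hY hY'
    have e1 : Y ∪ B = insert b Y := by
      ext w
      simp only [Set.mem_union, Set.mem_insert_iff]
      constructor
      · rintro (hw | hw)
        · exact Or.inr hw
        · by_cases hwb : w = b
          · exact Or.inl hwb
          · exact Or.inr (hY ⟨hw, hwb⟩)
      · rintro (rfl | hw)
        · exact Or.inr hb
        · exact Or.inl hw
    have e2 : Y ∩ B = B \ {b} := by
      ext w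
      constructor
      · rintro ⟨hw, hwB⟩
        refine ⟨hwB, ?_⟩
        rintro rfl
        rcases hY' hw with h | h
        · exact h.2 rfl
        · exact hbE h
      · exact fun hw => ⟨hY hw, hw.1⟩
    have hin : ∀ w ∈ Y ∪ B, w ≠ b → w ∈ Y := by
      intro w hw hwb
      rw [e1] at hw
      exact hw.resolve_left hwb
    have hout : ∀ w ∈ Y ∪ B, w ∉ B → w ∈ E := by
      rintro w (hw | hw) hwB
      · exact (hY' hw).resolve_left fun h => hwB h.1
      · exact absurd hw hwB
    have hBE : ∀ w ∈ Y ∪ B, w ∈ B ∪ E := by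
      intro w hw
      by_cases hwB : w ∈ B
      · exact Or.inl hwB
      · exact Or.inr (hout w hw hwB)
    have hb' : ∀ y z, y ∈ Y ∪ B → z ∈ Y ∪ B → M.rel b y z → y ∈ B ∧ z ∈ B := by
      intro y z hy hz r
      constructor
      · by_contra hyB
        exact hcon y (hout y hy hyB) z (hBE z hz) r
      · by_contra hzB
        exact hcon z (hout z hz hzB) y (hBE y hy) (hM.hyper.swap_right r)
    rw [← e1, ← e2]
    refine hM.delta_free fun x hx y hy z hz r => ?_
    by_cases hxb : x = b
    · subst hxb
      obtain ⟨h1, h2⟩ := hb' y z hy hz r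
      right
      rintro w (rfl | rfl | rfl) <;> assumption
    by_cases hyb : y = b
    · subst hyb
      obtain ⟨h1, h2⟩ := hb' x z hx hz (hM.hyper.swap r)
      right
      rintro w (rfl | rfl | rfl) <;> assumption
    by_cases hzb : z = b
    · subst hzb
      obtain ⟨h1, h2⟩ := hb' x y hx hy (hM.hyper.rotate (hM.hyper.rotate r))
      right
      rintro w (rfl | rfl | rfl) <;> assumption
    left
    rintro w (rfl | rfl | rfl)
    exacts [hin _ hx hxb, hin _ hy hyb, hin _ hz hzb]
  have hins : insert b (B \ {b}) = B := by simp [hb]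
  refine h.2 (B \ {b}) ⟨Set.sdiff_subset, fun hle => (hle hb).2 rfl⟩ (isZeroPrimitive_iff.2
    ⟨hne, hdisj.mono_right Set.sdiff_subset, ?_, fun Y hY hY' => ?_⟩)
  · have := key _ Set.subset_union_left subset_rfl
    rw [← Set.insert_union, hins] at this
    omega
  · have h1 := key Y hY.1 hY'.1
    have hbn : b ∉ B \ {b} ∪ E := by
      rintro (h | h)
      · exact h.2 rfl
      · exact hbE h
    have h2 := hlt (insert b Y) ?_ ?_
    · omega
    · refine ⟨fun w hw => ?_, fun hle => hY.2 fun w hw => ?_⟩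
      · by_cases hwb : w = b
        · exact Or.inl hwb
        · exact Or.inr (hY.1 ⟨hw, hwb⟩)
      · have hwb : w ≠ b := by
          rintro rfl
          exact hbn (hY'.1 hw)
        exact ⟨hle (Or.inr hw), hwb⟩
    · refine ⟨?_, fun hle => hY'.2 fun w hw => ?_⟩
      · rintro w (rfl | hw)
        · exact Or.inl hb
        · exact Set.union_subset_union_left _ Set.sdiff_subset (hY'.1 hw)
      · have hwb : w ≠ b := by
          rintro rfl
          exact hbn hw
        exact (hle (Set.union_subset_union_left _ Set.sdiff_subset hw)).resolve_left hwb

theorem IsTight.image (f : Emb M N) (hN : N.IsTripleSystem) {E B : Set M.carrier}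
    (h : M.IsTight E B) : N.IsTight (f.toFun '' E) (f.toFun '' B) := by
  refine ⟨(Set.disjoint_image_iff f.injective).2 h.disjoint, ?_, fun Y hY hY' => ?_, ?_⟩
  · rw [← Set.image_union, f.delta_image hN, f.delta_image hN, h.delta_eq]
  · rw [← Set.image_union] at hY'
    obtain ⟨Y, -, rfl⟩ := Set.subset_image_iff.1 hY'.1
    rw [f.delta_image hN, f.delta_image hN]
    rw [Set.ssubset_def, Set.image_subset_image_iff f.injective,
      Set.image_subset_image_iff f.injective] at hY hY'
    exact h.delta_lt Y hY hY'
  · rintro _ ⟨b, hb, rfl⟩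
    obtain ⟨e, he, z, hz, r⟩ := h.exists_rel b hb
    exact ⟨_, ⟨e, he, rfl⟩, _, by rw [← Set.image_union]; exact ⟨z, hz, rfl⟩,
      (f.rel_iff _ _ _).2 r⟩

/-- A partial intersection would give X ∩ (B ∪ E) predimension above that of B, and submodularity
would then make `delta (X ∪ E)` smaller than `delta X`. -/
theorem IsTight.subset_or_disjoint (hM : M.IsTripleSystem) {E B X : Set M.carrier}
    (h : M.IsTight E B) (hX : M.Strong X Set.univ) (hBX : B ⊆ X) : E ⊆ X ∨ Disjoint E X := by
  have h1 := hM.delta_submod X (B ∪ E)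
  have h2 := hX.2 (X ∪ (B ∪ E)) Set.subset_union_left (Set.subset_univ _)
  have h3 : B ⊆ X ∩ (B ∪ E) := Set.subset_inter hBX Set.subset_union_left
  have h4 : X ∩ (B ∪ E) ⊆ B ∪ E := Set.inter_subset_right
  have h5 := h.delta_eq
  rcases Set.eq_or_ssubset_of_subset h3 with h6 | h6
  · right
    refine Set.disjoint_left.2 fun e he heX => Set.disjoint_left.1 h.disjoint he ?_
    exact h6.ge ⟨heX, Or.inr he⟩
  rcases Set.eq_or_ssubset_of_subset h4 with h7 | h7
  · left
    exact fun e he => (h7.ge (Or.inr he)).1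
  have := h.delta_lt _ h6 h7
  omega

/-! ### Counting disjoint copies -/

/-- Disjoint tight extensions of `B` meeting a strong set that does not contain `B` are at most
`δ(B)` in number. -/
theorem KSp.encard_le_delta (hM : M.KSp) {X B : Set M.carrier} (hX : M.Strong X Set.univ)
    {b : M.carrier} (hb : b ∈ B) (hbX : b ∉ X) {F : Set (Set M.carrier)}
    (hF : ∀ E ∈ F, M.IsTight E B ∧ (E ∩ X).Nonempty) (hdisj : F.PairwiseDisjoint id) :
    (F.ncard : ℤ) ≤ M.delta B := by
  have hT := hM.isTripleSystem
  have := hT.finite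
  -- For W = B ∪ ⋃₀ F, each member of F lowers `delta W - delta (W ∩ X)` by at least 1. Strength of
  -- X keeps this difference nonnegative, so there are at most `delta B - delta (B ∩ X)` members.
  have key : ∀ F : Set (Set M.carrier), (∀ E ∈ F, M.IsTight E B ∧ (E ∩ X).Nonempty) →
      F.PairwiseDisjoint id →
      M.delta (B ∪ ⋃₀ F) + M.delta (B ∩ X) + F.ncard ≤
        M.delta B + M.delta ((B ∪ ⋃₀ F) ∩ X) := by
    intro F
    induction F, Set.toFinite F using Set.Finite.induction_on with
    | empty => simp
    | @insert E F hEF _ ih =>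
      intro hF hdisj
      have ih := ih (fun E' hE' => hF E' (Or.inr hE')) (hdisj.subset (Set.subset_insert _ _))
      obtain ⟨hE, hEX⟩ := hF E (Or.inl rfl)
      rw [Set.ncard_insert_of_notMem hEF]
      have eU : B ∪ ⋃₀ insert E F = (B ∪ ⋃₀ F) ∪ E := by
        rw [Set.sUnion_insert, Set.union_comm E, Set.union_assoc]
      rw [eU]
      have hEW : ∀ e ∈ E, e ∉ B ∪ ⋃₀ F := by
        rintro e he (h | ⟨E', hE', h⟩)
        · exact Set.disjoint_left.1 hE.disjoint he h
        · exact Set.disjoint_left.1 (hdisj (Or.inl rfl) (Or.inr hE') fun h => hEF (h ▸ hE')) he h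
      have hBW : B ⊆ B ∪ ⋃₀ F := Set.subset_union_left
      generalize B ∪ ⋃₀ F = W at *
      suffices h : M.delta (W ∪ E) + M.delta (W ∩ X) < M.delta W + M.delta ((W ∪ E) ∩ X) by
        push_cast
        omega
      -- If E lies in X, the drop comes from a triple through b ∉ X and a point of E. Otherwise it
      -- comes from primitivity: B ∪ (E ∩ X) lies strictly between B and B ∪ E.
      by_cases hEsub : E ⊆ X
      · obtain ⟨e, he, z, hz, r⟩ := hE.exists_rel b hb
        have e1 : W ∪ (W ∪ E) ∩ X = W ∪ E := by
          ext w
          have := @hEsub w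
          simp; tauto
        have e2 : W ∩ ((W ∪ E) ∩ X) = W ∩ X := by
          ext w
          simp; tauto
        have h1 := hT.delta_submod_lt (S := W) (T := (W ∪ E) ∩ X) r
          (by rw [e1]; exact Or.inl (hBW hb)) (by rw [e1]; exact Or.inr he)
          (by rw [e1]; exact Set.union_subset_union_left _ hBW hz)
          (fun h => hEW e he (h (by simp))) (fun h => hbX (h (by simp) : b ∈ _).2)
        rwa [e1, e2] at h1
      · have h1 := hT.delta_submod W ((W ∪ E) ∩ X)
        have e1 : W ∪ (W ∪ E) ∩ X = W ∪ E ∩ X := by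
          ext w
          simp; tauto
        have e2 : W ∩ ((W ∪ E) ∩ X) = W ∩ X := by
          ext w
          simp; tauto
        rw [e1, e2] at h1
        have h2 := hT.delta_submod (W ∪ E ∩ X) (B ∪ E)
        have e3 : (W ∪ E ∩ X) ∪ (B ∪ E) = W ∪ E := by
          ext w
          have := @hBW w
          simp; tauto
        have e4 : (W ∪ E ∩ X) ∩ (B ∪ E) = B ∪ E ∩ X := by
          ext w
          have := @hBW w
          have := hEW w
          simp; tauto
        rw [e3, e4, hE.delta_eq] at h2
        have h3 := hE.delta_lt (B ∪ E ∩ X) ?_ ?_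
        · omega
        · obtain ⟨e, he, heX⟩ := hEX
          exact ⟨Set.subset_union_left, fun hle => hEW e he (hBW (hle (Or.inr ⟨he, heX⟩)))⟩
        · obtain ⟨e, he, heX⟩ := Set.not_subset.1 hEsub
          refine ⟨Set.union_subset_union_right _ Set.inter_subset_left, fun hle => ?_⟩
          rcases hle (Or.inr he) with h | h
          · exact hEW e he (hBW h)
          · exact heX h.2
  have h1 := key F hF hdisj
  have h2 := hT.strong_inter hX (B ∪ ⋃₀ F)
  rw [Set.univ_inter, Set.inter_comm] at h2
  have h3 := hM.delta_nonneg (B ∩ X)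
  omega

theorem GoodPair.isTight (P : GoodPair.{u}) : P.str.IsTight P.baseᶜ P.base :=
  P.good.isTight P.mem.isTripleSystem

/-- A good pair with a single new point is the pair `α`. -/
theorem GoodPair.exists_rel_of_ncard_eq_one (P : GoodPair.{u}) (h : P.baseᶜ.ncard = 1) :
    ∃ b₁ ∈ P.base, ∃ b₂ ∈ P.base, ∃ a, P.baseᶜ = {a} ∧ P.str.rel b₁ b₂ a ∧ P.IsAlpha := by
  have hT := P.mem.isTripleSystem
  have := hT.finite
  obtain ⟨a, ha⟩ := Set.ncard_eq_one.1 h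
  have hP := P.isTight
  have haB : a ∉ P.base := by
    have : a ∈ P.baseᶜ := ha ▸ rfl
    exact this
  rw [ha] at hP
  have hne : P.base.Nonempty := by
    by_contra hne
    rw [Set.not_nonempty_iff_eq_empty] at hne
    have h1 := hP.delta_eq
    rw [hne, hT.delta_eq, hT.delta_eq, hT.triples_eq_empty (by simp),
      hT.triples_eq_empty (by simp)] at h1
    simp at h1
  have hrel : ∀ b ∈ P.base, ∃ z ∈ P.base, P.str.rel b z a := by
    intro b hb
    obtain ⟨e, rfl, z, hz, r⟩ := hP.exists_rel b hb
    refine ⟨z, hz.resolve_right fun h => ?_, hT.hyper.swap_right r⟩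
    exact (hT.hyper.1 _ _ _ r).2.2 h.symm
  obtain ⟨b, hb⟩ := hne
  obtain ⟨z, hz, r⟩ := hrel b hb
  have hbz := (hT.hyper.1 _ _ _ r).1
  have hbase : P.base = {b, z} := by
    -- A third base point would lie in a further triple with a, making `delta` of the whole smaller
    -- than that of the base.
    refine Set.Subset.antisymm (fun b' hb' => ?_) (by simp [Set.insert_subset_iff, hb, hz])
    by_contra hnot
    obtain ⟨z', hz', r'⟩ := hrel b' hb'
    have haz : a ∉ ({b, z} : Set P.str.carrier) := by
      rintro (rfl | rfl)
      · exact haB hb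
      · exact haB hz
    have e1 : P.base ∪ insert a {b, z} = P.base ∪ {a} := by
      ext w
      simp only [Set.mem_union, Set.mem_insert_iff, Set.mem_singleton_iff]
      constructor
      · rintro (h | h | rfl | rfl) <;> tauto
      · tauto
    have e2 : P.base ∩ insert a {b, z} = {b, z} := by
      ext w
      simp only [Set.mem_inter_iff, Set.mem_insert_iff, Set.mem_singleton_iff]
      constructor
      · rintro ⟨h, rfl | h⟩
        · exact absurd h haB
        · exact h
      · rintro (rfl | rfl) <;> simp [hb, hz]
    have h1 := hT.delta_submod_lt (S := P.base) (T := insert a {b, z}) r' (Or.inl hb')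
      (Or.inl hz') (Or.inr (Or.inl rfl)) (fun h => haB (h (by simp))) (fun h => by
        rcases h (by simp : b' ∈ _) with h | h
        · exact haB (h ▸ hb')
        · exact hnot h)
    rw [e1, e2, hP.delta_eq] at h1
    have h2 := hT.delta_insert_le (S := {b, z}) r (by simp) (by simp) haz
    omega
  exact ⟨b, hb, z, hz, a, ha, r, b, z, a, hbz, hbase, ha, r⟩

/-- The third point of a triple is unique, so a value of at least 1 at `α` is never exceeded. -/
theorem GoodPair.copies_subsingleton (P : GoodPair.{u}) (h : P.baseᶜ.ncard = 1)
    (hM : M.IsTripleSystem) (f : P.base → M.carrier) : (M.copies P f).Subsingleton := by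
  obtain ⟨b₁, hb₁, b₂, hb₂, a, ha, r, -⟩ := P.exists_rel_of_ncard_eq_one h
  rintro _ ⟨g, hg, rfl⟩ _ ⟨g', hg', rfl⟩
  have r1 := (g.rel_iff _ _ _).2 r
  have r2 := (g'.rel_iff _ _ _).2 r
  rw [hg ⟨b₁, hb₁⟩, hg ⟨b₂, hb₂⟩] at r1
  rw [hg' ⟨b₁, hb₁⟩, hg' ⟨b₂, hb₂⟩] at r2
  rw [ha, Set.image_singleton, Set.image_singleton, hM.unique r1 r2]

theorem KSpMu.encard_le {μ : GoodPairType.{u} → ℕ} (hM : M.KSpMu μ) (P : GoodPair.{u})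
    (f : P.base → M.carrier) {F : Set (Set M.carrier)} (hF : F ⊆ M.copies P f)
    (hdisj : F.PairwiseDisjoint id) : F.encard ≤ μ P.type :=
  (le_iSup₂_of_le (f := fun (F : Set (Set M.carrier)) _ => F.encard) F ⟨hF, hdisj⟩ le_rfl).trans
    (hM.2 P f)

theorem KSp.kspMu {μ : GoodPairType.{u} → ℕ} (hM : M.KSp)
    (h : ∀ (P : GoodPair.{u}) (f : P.base → M.carrier) (F : Set (Set M.carrier)),
      F ⊆ M.copies P f → F.PairwiseDisjoint id → F.encard ≤ μ P.type) : M.KSpMu μ :=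
  ⟨hM, fun P f => iSup₂_le fun F hF => h P f F hF.1 hF.2⟩

/-- Copies of a good pair inside the image of a structure in `KSpMu μ` respect the bound. -/
theorem KSpMu.encard_le_of_emb {A D : TernStr.{u}} {μ : GoodPairType.{u} → ℕ} (hA : A.KSpMu μ)
    (f : Emb A D) (P : GoodPair.{u}) (b : P.base → D.carrier) {F : Set (Set D.carrier)}
    (hF : F ⊆ D.copies P b) (hdisj : F.PairwiseDisjoint id) (hFf : ∀ E ∈ F, E ⊆ f.image)
    (hb : ∀ x, b x ∈ f.image) : F.encard ≤ μ P.type := by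
  choose b' hb' using hb
  have hinj : Set.InjOn (fun E => f.toFun ⁻¹' E) F := by
    intro E hE E' hE' h
    have h' : f.toFun '' (f.toFun ⁻¹' E) = f.toFun '' (f.toFun ⁻¹' E') := congrArg _ h
    rwa [Set.image_preimage_eq_of_subset (hFf E hE),
      Set.image_preimage_eq_of_subset (hFf E' hE')] at h'
  rw [← hinj.encard_image]
  refine hA.encard_le P b' ?_ ?_
  · rintro _ ⟨E, hE, rfl⟩
    obtain ⟨g, hg, hgE⟩ := hF hE
    obtain ⟨p, hp⟩ := g.exists_factor f (by
      rintro _ ⟨x, rfl⟩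
      by_cases hx : x ∈ P.base
      · exact ⟨_, (hb' ⟨x, hx⟩).trans (hg ⟨x, hx⟩).symm⟩
      · exact hFf E hE (hgE ▸ ⟨x, hx, rfl⟩))
    refine ⟨p, fun x => f.injective (by rw [hp, hg, hb']), ?_⟩
    ext a
    constructor
    · rintro ⟨x, hx, rfl⟩
      rw [Set.mem_preimage, hp, ← hgE]
      exact ⟨x, hx, rfl⟩
    · intro ha
      rw [Set.mem_preimage, ← hgE] at ha
      obtain ⟨x, hx, hxa⟩ := ha
      exact ⟨x, hx, f.injective (by rw [hp, hxa])⟩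
  · rintro _ ⟨E, hE, rfl⟩ _ ⟨E', hE', rfl⟩ hne
    exact (hdisj hE hE' (fun h => hne (h ▸ rfl))).preimage f.toFun

theorem Emb.kspMu {μ : GoodPairType.{u} → ℕ} (f : Emb M N) (hN : N.KSpMu μ) : M.KSpMu μ := by
  refine (f.ksp hN.1).kspMu fun P b F hF hdisj => ?_
  rw [← f.injective.image_injective.encard_image]
  refine hN.encard_le P (f.toFun ∘ b) ?_ ?_
  · rintro _ ⟨E, hE, rfl⟩
    obtain ⟨g, hg, rfl⟩ := hF hE
    exact ⟨f.comp g, fun x => congrArg f.toFun (hg x), Set.image_comp f.toFun g.toFun _⟩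
  · rintro _ ⟨E, hE, rfl⟩ _ ⟨E', hE', rfl⟩ hne
    exact (Set.disjoint_image_iff f.injective).2 (hdisj hE hE' fun h => hne (h ▸ rfl))

/-! ### Amalgamation under the bounds `μ` -/

/-- In the free union of `X` and `Y`, with `X` primitive over `X ∩ Y`, the bounds given by `μ`
can only be violated if `X \ Y` has a copy in `Y \ X` over `X ∩ Y`. -/
theorem IsFreeUnion.exists_twin {D : TernStr.{u}} {X Y : Set D.carrier} (h : D.IsFreeUnion X Y)
    (hD : D.KSp) (hX : D.Strong X Set.univ) (hY : D.Strong Y Set.univ)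
    (hZ : D.Strong (X ∩ Y) Set.univ)
    (hprim : ∀ W, X ∩ Y ⊂ W → W ⊆ X → D.Strong W Set.univ → W = X)
    {μ : GoodPairType.{u} → ℕ} (hμ : IsAdmissible μ) (P : GoodPair.{u})
    (b : P.base → D.carrier) {F : Set (Set D.carrier)} (hF : F ⊆ D.copies P b)
    (hdisj : F.PairwiseDisjoint id) (hlt : (μ P.type : ℕ∞) < F.encard)
    (bX : (∀ E ∈ F, E ⊆ X) → (∀ x, b x ∈ X) → F.encard ≤ μ P.type)
    (bY : (∀ E ∈ F, E ⊆ Y) → (∀ x, b x ∈ Y) → F.encard ≤ μ P.type) :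
    ∃ p q : Emb P.str D, (∀ x ∈ P.base, p.toFun x = q.toFun x) ∧
      (∀ x ∈ P.base, p.toFun x ∈ X ∩ Y) ∧ p.toFun '' P.baseᶜ = X \ Y ∧
      q.toFun '' P.baseᶜ ⊆ Y \ X := by
  have hT := hD.isTripleSystem
  have := hT.finite
  have := P.mem.1
  have hC : 2 ≤ P.baseᶜ.ncard := by
    have hne : 0 < P.baseᶜ.ncard := by
      rw [Set.ncard_pos]
      exact P.good.1.1
    by_contra hcon
    have h1 : P.baseᶜ.ncard = 1 := by omega
    obtain ⟨-, -, -, -, -, -, -, hα⟩ := P.exists_rel_of_ncard_eq_one h1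
    have h2 : F.encard ≤ 1 := Set.encard_le_one_iff.2 fun E E' hE hE' =>
      P.copies_subsingleton h1 hT b (hF hE) (hF hE')
    have h3 : ((1 : ℕ) : ℕ∞) ≤ μ P.type := by exact_mod_cast (hμ P).2 hα
    exact absurd (h2.trans h3) (not_le.2 hlt)
  have hbound := (hμ P).1 hC
  have hcopy : ∀ E ∈ F, ∃ g : Emb P.str D, (∀ x ∈ P.base, g.toFun x ∈ Set.range b) ∧
      g.toFun '' P.base = Set.range b ∧ g.toFun '' P.baseᶜ = E ∧
      ∀ x (hx : x ∈ P.base), g.toFun x = b ⟨x, hx⟩ := by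
    intro E hE
    obtain ⟨g, hg, hgE⟩ := hF hE
    refine ⟨g, fun x hx => ⟨_, (hg ⟨x, hx⟩).symm⟩, ?_, hgE, fun x hx => hg ⟨x, hx⟩⟩
    ext w
    constructor
    · rintro ⟨x, hx, rfl⟩
      exact ⟨_, (hg ⟨x, hx⟩).symm⟩
    · rintro ⟨x, rfl⟩
      exact ⟨x, x.2, hg x⟩
  have htight : ∀ E ∈ F, D.IsTight E (Set.range b) := by
    intro E hE
    obtain ⟨g, -, h1, h2, -⟩ := hcopy E hE
    rw [← h1, ← h2]
    exact P.isTight.image g hT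
  have hne : ∃ E, E ∈ F := by
    by_contra hcon
    have : F = ∅ := Set.eq_empty_of_forall_notMem fun E hE => hcon ⟨E, hE⟩
    simp [this] at hlt
  have hdelta : D.delta (Set.range b) = P.str.delta P.base := by
    obtain ⟨E, hE⟩ := hne
    obtain ⟨g, -, h1, -, -⟩ := hcopy E hE
    rw [← h1, g.delta_image hT]
  have hEne : ∀ E ∈ F, E.Nonempty := by
    intro E hE
    obtain ⟨g, -, -, rfl, -⟩ := hcopy E hE
    exact P.good.1.1.image _
  by_cases hbY : Set.range b ⊆ Y
  · have h1 : ∃ E ∈ F, ¬ E ⊆ Y := by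
      by_contra hcon
      push Not at hcon
      exact absurd (bY hcon fun x => hbY ⟨x, rfl⟩) (not_le.2 hlt)
    -- A copy not inside Y avoids Y. Every base point shares a triple with it, and no triple
    -- crosses, so the whole base lies in X ∩ Y.
    obtain ⟨E, hE, hEY⟩ := h1
    have hEd := ((htight E hE).subset_or_disjoint hT hY hbY).resolve_left hEY
    have hEX : E ⊆ X := fun e he =>
      ((h.1 ▸ Set.mem_univ e : e ∈ X ∪ Y)).resolve_right (Set.disjoint_left.1 hEd he)
    have hbX : Set.range b ⊆ X := by
      intro c hc
      obtain ⟨e, he, z, hz, r⟩ := (htight E hE).exists_rel c hc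
      rcases h.2 _ _ _ r with h | h
      · exact h (by simp)
      · exact absurd (h (by simp)) (Set.disjoint_left.1 hEd he)
    have hEeq : E = X \ Y := by
      -- Adding E to X ∩ Y does not raise `delta`, so the result is strong, and primitivity of X
      -- makes it all of X.
      have hW : X ∩ Y ∪ E = X := by
        obtain ⟨e, he⟩ := hEne E hE
        refine hprim _ ⟨Set.subset_union_left, fun hle => ?_⟩
          (Set.union_subset Set.inter_subset_left hEX) (hZ.of_delta_le Set.subset_union_left
            (Set.subset_univ _) ?_)
        · exact Set.disjoint_left.1 hEd he (hle (Or.inr he)).2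
        · have h1 := hT.delta_submod (X ∩ Y) (Set.range b ∪ E)
          have e1 : X ∩ Y ∪ (Set.range b ∪ E) = X ∩ Y ∪ E := by
            rw [← Set.union_assoc, Set.union_eq_self_of_subset_right (Set.subset_inter hbX hbY)]
          have e2 : X ∩ Y ∩ (Set.range b ∪ E) = Set.range b := by
            ext w
            constructor
            · rintro ⟨hw, hw' | hw'⟩
              · exact hw'
              · exact absurd hw.2 (Set.disjoint_left.1 hEd hw')
            · exact fun hw => ⟨⟨hbX hw, hbY hw⟩, Or.inl hw⟩
          rw [e1, e2, (htight E hE).delta_eq] at h1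
          omega
      ext w
      constructor
      · exact fun hw => ⟨hEX hw, Set.disjoint_left.1 hEd hw⟩
      · rintro ⟨hw, hw'⟩
        rw [← hW] at hw
        exact hw.resolve_left fun h => hw' h.2
    have h2 : ∃ E ∈ F, ¬ E ⊆ X := by
      by_contra hcon
      push Not at hcon
      exact absurd (bX hcon fun x => hbX ⟨x, rfl⟩) (not_le.2 hlt)
    obtain ⟨E', hE', hEX'⟩ := h2
    have hEd' := ((htight E' hE').subset_or_disjoint hT hX hbX).resolve_left hEX'
    obtain ⟨p, hp1, -, hp2, hp3⟩ := hcopy E hE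
    obtain ⟨q, -, -, hq2, hq3⟩ := hcopy E' hE'
    refine ⟨p, q, fun x hx => (hp3 x hx).trans (hq3 x hx).symm,
      fun x hx => ⟨hbX (hp1 x hx), hbY (hp1 x hx)⟩, hp2.trans hEeq, ?_⟩
    rw [hq2]
    exact fun e he => ⟨((h.1 ▸ Set.mem_univ e : e ∈ X ∪ Y)).resolve_left
      (Set.disjoint_left.1 hEd' he), Set.disjoint_left.1 hEd' he⟩
  · exfalso
    obtain ⟨c, hc, hcY⟩ := Set.not_subset.1 hbY
    -- A triple joining c ∉ Y to a point of E must lie in X. If the base lies in X, all copies then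
    -- do too; if not, the `delta` count bounds them.
    have hmeet : ∀ E ∈ F, (E ∩ X).Nonempty := by
      intro E hE
      obtain ⟨e, he, z, hz, r⟩ := (htight E hE).exists_rel c hc
      rcases h.2 _ _ _ r with h | h
      · exact ⟨e, he, h (by simp)⟩
      · exact absurd (h (by simp)) hcY
    by_cases hbX : Set.range b ⊆ X
    · refine absurd (bX (fun E hE => ?_) fun x => hbX ⟨x, rfl⟩) (not_le.2 hlt)
      refine ((htight E hE).subset_or_disjoint hT hX hbX).resolve_right fun hd => ?_
      obtain ⟨e, he, heX⟩ := hmeet E hE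
      exact Set.disjoint_left.1 hd he heX
    · obtain ⟨d, hd, hdX⟩ := Set.not_subset.1 hbX
      have h1 := hD.encard_le_delta hX hd hdX (fun E hE => ⟨htight E hE, hmeet E hE⟩) hdisj
      rw [← (Set.toFinite F).cast_ncard_eq] at hlt
      have h2 : μ P.type < F.ncard := by exact_mod_cast hlt
      omega

theorem exists_strong_amalgam_kspMu {μ : GoodPairType.{u} → ℕ} (hμ : IsAdmissible μ) (n : ℕ) :
    ∀ (A B C : TernStr.{u}), A.KSpMu μ → B.KSpMu μ → ∀ (i : Emb C A) (j : Emb C B),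
      i.IsStrong → j.IsStrong → Nat.card A.carrier - Nat.card C.carrier = n →
      ∃ (D : TernStr.{u}) (f : Emb A D) (g : Emb B D),
        D.KSpMu μ ∧ f.IsStrong ∧ g.IsStrong ∧ ∀ c, f.toFun (i.toFun c) = g.toFun (j.toFun c) := by
  induction n using Nat.strong_induction_on with
  | _ n ih =>
  intro A B C hA hB i j hi hj hn
  have hAT := hA.1.isTripleSystem
  have hBT := hB.1.isTripleSystem
  have := hAT.finite
  by_cases hs : SharesExtendedLine i j
  · obtain ⟨C', k, i', j', hk1, hk2, hi', hj', hlt⟩ := hs.exists_extension hAT hBT hi hj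
    have := Nat.card_le_card_of_injective _ i'.injective
    obtain ⟨D, f, g, hD, hf, hg, hfg⟩ := ih _ (by omega) A B C' hA hB i' j' hi' hj' rfl
    exact ⟨D, f, g, hD, hf, hg, fun c => by rw [← hk1, ← hk2, hfg]⟩
  by_cases hint : ∃ W, i.image ⊂ W ∧ W ≠ Set.univ ∧ A.Strong W Set.univ
  · obtain ⟨W, hW, hW', hWs⟩ := hint
    obtain ⟨k, hk⟩ := i.exists_factor (A.subEmb W) (by rw [image_subEmb]; exact hW.1)
    have hks : k.IsStrong := by
      rw [Emb.IsStrong, ← (A.subEmb W).strong_image_iff hAT, ← Emb.image_comp,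
        ← Emb.image_eq, image_subEmb]
      have e : ((A.subEmb W).comp k).image = i.image := congrArg Set.range (funext hk)
      rw [e]
      exact hi.mono hW.1 (Set.subset_univ _)
    have h1 : i.image.ncard < W.ncard := Set.ncard_lt_ncard hW
    have h2 : W.ncard < (Set.univ : Set A.carrier).ncard :=
      Set.ncard_lt_ncard (Set.ssubset_univ_iff.2 hW')
    have h3 : i.image.ncard = Nat.card C.carrier := Nat.card_range_of_injective i.injective
    rw [Set.ncard_univ] at h2
    have h4 : Nat.card (A.sub W).carrier = W.ncard := rfl
    -- First W is amalgamated with B over C, then A with the result over W. The measure ignores the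
    -- second structure, so the size of `D₁` is harmless.
    obtain ⟨D₁, f₁, g₁, hD₁, hf₁, hg₁, hfg₁⟩ := ih _ (by omega) (A.sub W) B C
      ((A.subEmb W).kspMu hA) hB k j hks hj rfl
    obtain ⟨D, f, g, hD, hf, hg, hfg⟩ := ih _ (by omega) A D₁ (A.sub W) hA hD₁ (A.subEmb W) f₁
      (isStrong_subEmb hWs) hf₁ rfl
    refine ⟨D, f, g.comp g₁, hD, hf, hg.comp hD.1.isTripleSystem hg₁, fun c => ?_⟩
    rw [← hk, hfg, hfg₁]
    rfl
  obtain ⟨D, f, g, hD, hf, hg, hfg, hfree, hinter⟩ := exists_strong_free_amalgam hA.1 hB.1 hi hj hs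
  have hT := hD.isTripleSystem
  by_cases hDμ : D.KSpMu μ
  · exact ⟨D, f, g, hDμ, hf, hg, hfg⟩
  have hbad : ∃ (P : GoodPair.{u}) (b : P.base → D.carrier) (F : Set (Set D.carrier)),
      F ⊆ D.copies P b ∧ F.PairwiseDisjoint id ∧ (μ P.type : ℕ∞) < F.encard := by
    by_contra hcon
    push Not at hcon
    exact hDμ (hD.kspMu hcon)
  obtain ⟨P, b, F, hF, hdisj, hlt⟩ := hbad
  have hZi : f.image ∩ g.image = f.toFun '' i.image := by
    rw [hinter, ← f.image_comp]; rfl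
  have hZ : D.Strong (f.image ∩ g.image) Set.univ := by
    have := hf.comp hT hi
    rwa [Emb.IsStrong, f.image_comp, ← hZi] at this
  have hprim : ∀ W, f.image ∩ g.image ⊂ W → W ⊆ f.image → D.Strong W Set.univ →
      W = f.image := by
    intro W hW hWf hWs
    rw [f.image_eq] at hWf ⊢
    obtain ⟨V, -, rfl⟩ := Set.subset_image_iff.1 hWf
    by_contra hne
    refine hint ⟨V, ?_, fun h => hne (h ▸ rfl), ?_⟩
    · rw [hZi, Set.ssubset_def, Set.image_subset_image_iff f.injective,
        Set.image_subset_image_iff f.injective] at hW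
      exact hW
    · rw [← f.strong_image_iff hT]
      exact hWs.mono hWf (Set.subset_univ _)
  obtain ⟨p, q, hpq, hpZ, hpC, hqC⟩ := hfree.exists_twin hD hf hg hZ hprim hμ P b hF hdisj hlt
    (fun h1 h2 => hA.encard_le_of_emb f P b hF hdisj h1 h2)
    (fun h1 h2 => hB.encard_le_of_emb g P b hF hdisj h1 h2)
  obtain ⟨p', hp'⟩ := p.exists_factor f (by
    rintro _ ⟨x, rfl⟩
    by_cases hx : x ∈ P.base
    · exact (hpZ x hx).1
    · have : p.toFun x ∈ f.image \ g.image := hpC ▸ ⟨x, hx, rfl⟩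
      exact this.1)
  obtain ⟨q', hq'⟩ := q.exists_factor g (by
    rintro _ ⟨x, rfl⟩
    by_cases hx : x ∈ P.base
    · exact hpq x hx ▸ (hpZ x hx).2
    · exact (hqC ⟨x, hx, rfl⟩).1)
  have hs1 : ∀ x ∈ P.base, ∃ c, i.toFun c = p'.toFun x ∧ j.toFun c = q'.toFun x := by
    intro x hx
    have h1 := hpZ x hx
    rw [hinter] at h1
    obtain ⟨c, hc : f.toFun (i.toFun c) = p.toFun x⟩ := h1
    refine ⟨c, f.injective (by rw [hp', hc]), g.injective ?_⟩
    rw [hq', ← hpq x hx, ← hc, hfg]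
  have hpn : ∀ x ∉ P.base, p'.toFun x ∉ i.image := by
    rintro x hx ⟨c, hc⟩
    have : p.toFun x ∈ f.image \ g.image := hpC ▸ ⟨x, hx, rfl⟩
    refine this.2 ⟨j.toFun c, ?_⟩
    rw [← hfg, hc, hp']
  have hqn : ∀ x ∉ P.base, q'.toFun x ∉ j.image := by
    rintro x hx ⟨c, hc⟩
    refine (hqC ⟨x, hx, rfl⟩).2 ⟨i.toFun c, ?_⟩
    rw [hfg, hc, hq']
  have htri : ∀ {N : TernStr.{u}} (_ : N.IsTripleSystem) (l : Emb C N) (r : Emb P.str N),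
      l.IsStrong → (∀ x ∈ P.base, r.toFun x ∈ l.image) → (∀ x ∉ P.base, r.toFun x ∉ l.image) →
      N.delta r.image ≤ N.delta (l.image ∩ r.image) := by
    intro N hN l r hl h1 h2
    have e : l.image ∩ r.image = r.toFun '' P.base := by
      ext w
      constructor
      · rintro ⟨hw, x, rfl⟩
        by_cases hx : x ∈ P.base
        · exact ⟨x, hx, rfl⟩
        · exact absurd hw (h2 x hx)
      · rintro ⟨x, hx, rfl⟩
        exact ⟨h1 x hx, x, rfl⟩
    rw [e, r.image_eq, r.delta_image hN, r.delta_image hN, ← P.isTight.delta_eq,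
      Set.union_compl_self]
  have hs2 : ∀ x ∈ P.base, p'.toFun x ∈ i.image := fun x hx => by
    obtain ⟨c, hc, -⟩ := hs1 x hx
    exact ⟨c, hc⟩
  have hs3 : ∀ x ∈ P.base, q'.toFun x ∈ j.image := fun x hx => by
    obtain ⟨c, -, hc⟩ := hs1 x hx
    exact ⟨c, hc⟩
  have hdq := htri hBT j q' hj hs3 hqn
  have hcov : i.image ∪ p'.image = Set.univ := by
    refine Set.eq_univ_of_forall fun a => ?_
    by_cases ha : f.toFun a ∈ g.image
    · have h1 : f.toFun a ∈ f.image ∩ g.image := ⟨⟨a, rfl⟩, ha⟩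
      rw [hinter] at h1
      obtain ⟨c, hc⟩ := h1
      exact Or.inl ⟨c, f.injective hc⟩
    · have h1 : f.toFun a ∈ p.toFun '' P.baseᶜ := hpC ▸ ⟨⟨a, rfl⟩, ha⟩
      obtain ⟨x, -, hx⟩ := h1
      exact Or.inr ⟨x, f.injective (by rw [hp', hx])⟩
  have hA3 := hAT.rel_of_delta_union hi (htri hAT i p' hi hs2 hpn)
  rw [hcov] at hA3
  obtain ⟨h, h1, h2⟩ := exists_emb_of_cover i j p' q' P.base hs1 hpn hqn hcov
    (fun x y z => hA3 x trivial y trivial z trivial) (hBT.rel_of_delta_union hj hdq)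
  -- B serves as amalgam. The image of A is that of C plus the twin copy, whose `delta` does not
  -- exceed that of C, so it inherits strength.
  refine ⟨B, h, Emb.refl B, hB, ?_, Emb.isStrong_refl B, fun c => h1 c⟩
  have himage : h.image = j.image ∪ q'.image := by
    rw [h.image_eq, ← hcov, Set.image_union, ← h.image_comp, ← h.image_comp]
    exact congrArg₂ (· ∪ ·) (congrArg Set.range (funext h1)) (congrArg Set.range (funext h2))
  rw [Emb.IsStrong, himage]
  refine Strong.of_delta_le (S := j.image) hj Set.subset_union_left (Set.subset_univ _) ?_
  have := hBT.delta_submod j.image q'.image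
  omega

end TernStr

/-! ### The theorem -/

theorem mainTheorem11 :
    TernStr.HasStrongAmalgamation TernStr.KSp.{u} ∧
    (∀ (A B C : TernStr.{u}), A.KSp → B.KSp → C.KSp →
      ∀ (i : TernStr.Emb C A) (j : TernStr.Emb C B), i.IsStrong → j.IsStrong →
        ∃ (D : TernStr.{u}) (f : TernStr.Emb A D) (g : TernStr.Emb B D),
          D.KSp ∧ f.IsStrong ∧ g.IsStrong ∧
          (∀ c, f.toFun (i.toFun c) = g.toFun (j.toFun c)) ∧
          D.IsFreeAmalgam f.image g.image ∧
          (¬ TernStr.SharesExtendedLine i j →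
            f.image ∩ g.image = Set.range (fun c => f.toFun (i.toFun c)))) ∧
    (∀ μ : TernStr.GoodPairType.{u} → ℕ, TernStr.IsAdmissible μ →
      TernStr.HasStrongAmalgamation (TernStr.KSpMu μ)) := by
  refine ⟨fun A B C hA hB _ i j hi hj => ?_, fun A B C hA hB _ i j hi hj =>
    TernStr.exists_isFreeAmalgam _ A B C hA hB i j hi hj rfl, fun μ hμ A B C hA hB _ i j hi hj =>
    TernStr.exists_strong_amalgam_kspMu hμ _ A B C hA hB i j hi hj rfl⟩
  obtain ⟨D, f, g, hD, hf, hg, hfg, -⟩ :=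
    TernStr.exists_isFreeAmalgam _ A B C hA hB i j hi hj rfl
  exact ⟨D, f, g, hD, hf, hg, hfg⟩
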